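/- Let $M\ge 1$ be an integer, let $0\le\theta_1<\dots<\theta_M<2\pi$, and let $$\Gamma=\bigcup_{j=1}^M\Gamma_j,\qquad \Gamma_j=\{(r\cos\theta_j,r\sin\theta_j):r\ge 0\},$$ be the corresponding star graph in $\mathbb R^2$. Let $\alpha\ge 0$, and consider in $L^2(\mathbb R^2)=L^2(\mathbb R^2\setminus\Gamma)$ (complex-valued functions) the sesquilinear form given by $$t_{\Gamma,\alpha}(u,u)=\int_{\mathbb R^2\setminus\Gamma}|\nabla u|^2\,dx+\alpha\int_\Gamma\big|[u]\big|^2\,d\sigma,\qquad D(t_{\Gamma,\alpha})=H^1(\mathbb R^2\setminus\Gamma),$$ where $\sigma$ is the arclength and $[u]\in L^2(\Gamma)$ is the jump of $u$ across $\Gamma$, i.e. with $N$ a unit normal field on $\Gamma\setminus\{0\}$, $[u](s)=\lim_{t\to0^+}\big(u(s+tN(s))-u(s-tN(s))\big)$ in the sense of Sobolev traces. Then there is a unique self-adjoint operator $T_{\Gamma,\alpha}$ in $L^2(\mathbb R^2)$ generated by $t_{\Gamma,\alpha}$, i.e. such that $u\in D(T_{\Gamma,\alpha})$ and $T_{\Gamma,\alpha}u=F$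 if and only if $u\in H^1(\mathbb R^2\setminus\Gamma)$, $F\in L^2(\mathbb R^2)$ and $t_{\Gamma,\alpha}(v,u)=\langle v,F\rangle_{L^2(\mathbb R^2)}$ for all $v\in H^1(\mathbb R^2\setminus\Gamma)$ (forms and inner products are conjugate linear in the first argument), and $$\mathrm{spec}\,T_{\Gamma,\alpha}=\mathrm{spec}_{\mathrm{ess}}\,T_{\Gamma,\alpha}=[0,\infty),\qquad \mathrm{spec}_{\mathrm{disc}}\,T_{\Gamma,\alpha}=\emptyset .$$ Here the discrete spectrum of a self-adjoint operator consists of the isolated points of the spectrum that are eigenvalues of finite multiplicity, and the essential spectrum is the rest of the spectrum. -/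

import Mathlib

open MeasureTheory Filter Topology
open scoped ContDiff

noncomputable section

namespace StarGraph

/-! ### The plane, star graphs, and the Sobolev space of the complement of a star graph -/

/-- The Euclidean plane. -/
abbrev Plane : Type := EuclideanSpace ℝ (Fin 2)

/-- The Hilbert space of (classes of) square integrable complex functions on the plane. -/
abbrev L2Plane : Type := Lp ℂ 2 (volume : Measure Plane)

/-- The Hilbert space of square integrable complex functions on the half-line `(0, ∞)`; a branch of
a star graph is parametrized by arclength through the distance to the vertex. -/
abbrev L2Branch : Type := Lp ℂ 2 ((volume : Measure ℝ).restrict (Set.Ioi 0))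

/-- The unit vector with polar angle `ϑ`. -/
def direction (ϑ : ℝ) : Plane := !₂[Real.cos ϑ, Real.sin ϑ]

/-- The unit normal to the half-line of polar angle `ϑ` (`direction ϑ` turned by `π / 2`). -/
def normal (ϑ : ℝ) : Plane := !₂[-Real.sin ϑ, Real.cos ϑ]

/-- The closed half-line `{(r, ϑ) : r ≥ 0}` in polar coordinates. -/
def branch (ϑ : ℝ) : Set Plane := {x | ∃ r : ℝ, 0 ≤ r ∧ x = r • direction ϑ}

/-- The union of the half-lines of polar angles `θ j`. -/
def starGraph {M : ℕ} (θ : Fin M → ℝ) : Set Plane := ⋃ j, branch (θ j)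

/-- The partial derivative of `φ` in the `i`-th coordinate. -/
def partialDeriv (i : Fin 2) (φ : Plane → ℂ) (x : Plane) : ℂ :=
  fderiv ℝ φ x (EuclideanSpace.single i 1)

/-- `w` is the weak derivative of `u` in the `i`-th coordinate on the open set `Ω`. It is used for
sets `Ω` whose complement is a null set, so that `L²(Ω)` is `L²` of the plane. -/
def HasWeakPartial (Ω : Set Plane) (i : Fin 2) (u w : L2Plane) : Prop :=
  ∀ φ : Plane → ℂ, ContDiff ℝ ∞ φ → HasCompactSupport φ → tsupport φ ⊆ Ω →
    ∫ x, u x * partialDeriv i φ x = -∫ x, w x * φ x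

/-- The Sobolev space `H¹(ℝ² \ Γ)` of the complement of a star graph `Γ`. -/
def sobolevH1 {M : ℕ} (θ : Fin M → ℝ) : Set L2Plane :=
  {u | ∀ i, ∃ w, HasWeakPartial (starGraph θ)ᶜ i u w}

open Classical in
/-- The weak derivative on `ℝ² \ Γ`, for `u ∈ H¹(ℝ² \ Γ)`. -/
def weakPartial {M : ℕ} (θ : Fin M → ℝ) (i : Fin 2) (u : L2Plane) : L2Plane :=
  if h : ∃ w, HasWeakPartial (starGraph θ)ᶜ i u w then h.choose else 0

/-! ### The jump -/

/-- `g` is the jump of `u` across the half-line of polar angle `ϑ`: with `e` the direction of the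
half-line and `N` its normal, `u (s e + t N) - u (s e - t N)` tends to `g s` as `t → 0⁺`, in `L²` on
compact subintervals of `(0, ∞)`. As `u` is a class modulo null sets, the restriction of `u` to a
parallel line makes sense for almost all `t` only, and the limit is along these `t`. -/
def IsJump (ϑ : ℝ) (u : L2Plane) (g : L2Branch) : Prop :=
  ∀ a b : ℝ, 0 < a → a < b →
    Tendsto
      (fun t : ℝ => ∫⁻ s in Set.Ioo a b,
        ‖u (s • direction ϑ + t • normal ϑ) - u (s • direction ϑ - t • normal ϑ) - g s‖ₑ ^ 2)
      (𝓝[>] (0 : ℝ) ⊓ ae volume) (𝓝 0)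

open Classical in
/-- The jump `[u]` across the half-line of polar angle `ϑ` as an element of `L²` of this half-line.
It exists for `u ∈ H¹(ℝ² \ Γ)`, by the Sobolev trace theorem. -/
def jump (ϑ : ℝ) (u : L2Plane) : L2Branch :=
  if h : ∃ g, IsJump ϑ u g then h.choose else 0

/-! ### The sesquilinear form and its operator -/

/-- The sesquilinear form
`t(u, v) = ∫_{ℝ² \ Γ} ⟨∇u, ∇v⟩ dx + α ∫_Γ conj [u] [v] dσ`, with form domain `H¹(ℝ² \ Γ)`
(conjugate linear in the first argument). -/
def form {M : ℕ} (θ : Fin M → ℝ) (α : ℝ) (u v : L2Plane) : ℂ :=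
  ∑ i, inner ℂ (weakPartial θ i u) (weakPartial θ i v)
    + (α : ℂ) * ∑ j, inner ℂ (jump (θ j) u) (jump (θ j) v)

/-- `T` is the self-adjoint operator generated by the form: `T` is self-adjoint, and `u ∈ D(T)` with
`T u = F` if and only if `u` is in the form domain and `t(v, u) = ⟨v, F⟩` for all `v` in the form
domain. -/
structure IsGeneratedByForm {M : ℕ} (θ : Fin M → ℝ) (α : ℝ) (T : L2Plane →ₗ.[ℂ] L2Plane) :
    Prop where
  isSelfAdjoint : IsSelfAdjoint T
  mem_graph_iff : ∀ u F : L2Plane, (u, F) ∈ T.graph ↔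
    u ∈ sobolevH1 θ ∧ ∀ v ∈ sobolevH1 θ, form θ α v u = inner ℂ v F

/-! ### Spectra of unbounded operators -/

variable {H : Type*} [NormedAddCommGroup H] [InnerProductSpace ℂ H]

/-- The resolvent set: `T - z` maps `D(T)` bijectively onto `H`, with a bounded inverse `R`. -/
def resolventSet (T : H →ₗ.[ℂ] H) : Set ℂ :=
  {z | ∃ R : H →L[ℂ] H,
    (∀ f : H, ∃ u : T.domain, (u : H) = R f ∧ T u - z • (u : H) = f) ∧
    (∀ u : T.domain, R (T u - z • (u : H)) = u)}

/-- The spectrum of an operator. -/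
def spec (T : H →ₗ.[ℂ] H) : Set ℂ := (resolventSet T)ᶜ

/-- The eigenspace `ker (T - z)`. -/
def eigenspace (T : H →ₗ.[ℂ] H) (z : ℂ) : Submodule ℂ H :=
  T.graph.comap (LinearMap.prod LinearMap.id (z • LinearMap.id))

/-- The discrete spectrum of a self-adjoint operator: the eigenvalues of finite multiplicity that
are isolated points of the spectrum. -/
def specDisc (T : H →ₗ.[ℂ] H) : Set ℂ :=
  {z | z ∈ spec T ∧ (∃ ε > 0, spec T ∩ Metric.ball z ε = {z}) ∧
    eigenspace T z ≠ ⊥ ∧ FiniteDimensional ℂ (eigenspace T z)}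

/-- The essential spectrum of a self-adjoint operator: the spectrum without the discrete spectrum. -/
def specEss (T : H →ₗ.[ℂ] H) : Set ℂ := spec T \ specDisc T

end StarGraph

end

/-!
The form `t` is nonnegative and closed on `H¹(ℝ² \ Γ)`, so it generates a nonnegative self-adjoint
operator; every `k² ≥ 0` is in its spectrum because the complement of a star graph contains
arbitrarily large balls, which carry cut-off plane waves of energy `k²` that do not see `Γ`. Hence
the spectrum is `[0, ∞)`, and a half-line has no isolated points, so the discrete spectrum is empty.

The analytic core is the trace theorem `exists_isJump`: every `u ∈ H¹(ℝ² \ Γ)` has a jump across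
each branch, bounded by the `H¹` norm. Near the vertex there is no room in the normal direction, so
`u` is followed along oblique lines, of direction `κ e ± n` with `κ` large, which stay in a sector
of the complement (`exists_sector_disjoint`). Testing the weak derivative with translates of test
functions gives `u (x + t q) - u x = ∫ σ in 0..t, ∂_q u (x + σ q)` for almost all `x`
(`ae_sub_eq_integral_of_weak_deriv`), and from this a trace with a quantitative rate of convergence
is extracted by Fubini's theorem (`exists_trace`, `lintegral_sub_trace_le`, `lintegral_trace_le`).
Continuity of translations in `L²` turns oblique into normal limits (`exists_isTrace`).

Boundedness of the jump makes the space `V` of triples `(u, ∇u, √α [u])` a closed subspace of a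
Hilbert space (`isClosed_formSpace`). With `J : V → L²` the embedding, the Riesz representation
theorem gives `(T + 1)⁻¹ = J J†`, a positive contraction: self-adjointness of `T` and invertibility
of `T - z` for `z ∉ [0, ∞)` are read off from it (`exists_selfAdjoint_of_form`,
`mem_resolventSet_of_form`). No spectral theory of unbounded operators is needed. The approximate
eigenfunctions are in `exists_approx_eigenfunction`.
-/

noncomputable section

namespace StarGraph

/-! ### Geometry of star graphs -/

section Geometry

variable {M : ℕ} (θ : Fin M → ℝ)

theorem mem_branch_iff (ϑ : ℝ) (x : Plane) : x ∈ branch ϑ ↔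
    -Real.sin ϑ * x 0 + Real.cos ϑ * x 1 = 0 ∧ 0 ≤ Real.cos ϑ * x 0 + Real.sin ϑ * x 1 := by
  have hsc := Real.sin_sq_add_cos_sq ϑ
  constructor
  · rintro ⟨r, hr, rfl⟩
    simp only [direction, PiLp.smul_apply, smul_eq_mul, Matrix.cons_val_zero, Matrix.cons_val_one,
      Matrix.cons_val_fin_one]
    refine ⟨by ring, ?_⟩
    have : Real.cos ϑ * (r * Real.cos ϑ) + Real.sin ϑ * (r * Real.sin ϑ) = r := by
      linear_combination r * hsc
    rwa [this]
  · rintro ⟨h1, h2⟩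
    refine ⟨_, h2, ?_⟩
    ext i
    fin_cases i
    · simp [direction]
      linear_combination (-Real.sin ϑ) * h1 - x 0 * hsc
    · simp [direction]
      linear_combination Real.cos ϑ * h1 - x 1 * hsc

theorem isClosed_starGraph : IsClosed (starGraph θ) := by
  refine isClosed_iUnion_of_finite fun j => ?_
  have : branch (θ j) = {x : Plane | -Real.sin (θ j) * x 0 + Real.cos (θ j) * x 1 = 0} ∩
      {x : Plane | 0 ≤ Real.cos (θ j) * x 0 + Real.sin (θ j) * x 1} := by
    ext x; exact mem_branch_iff _ x
  rw [this]
  exact (isClosed_eq (by fun_prop) (by fun_prop)).inter (isClosed_le (by fun_prop) (by fun_prop))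

theorem volume_starGraph : volume (starGraph θ) = 0 := by
  refine measure_iUnion_null fun j => ?_
  have hsub : branch (θ j) ⊆ (Submodule.span ℝ {direction (θ j)} : Submodule ℝ Plane) := by
    rintro x ⟨r, -, rfl⟩
    exact Submodule.smul_mem _ _ (Submodule.mem_span_singleton_self _)
  refine measure_mono_null hsub (Measure.addHaar_submodule _ _ fun h => ?_)
  have h1 := finrank_span_le_card (R := ℝ) ({direction (θ j)} : Set Plane)
  rw [h, finrank_top, finrank_euclideanSpace_fin] at h1
  simp at h1

theorem ae_mem_compl_starGraph : ∀ᵐ x : Plane, x ∈ (starGraph θ)ᶜ :=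
  measure_eq_zero_iff_ae_notMem.1 (volume_starGraph θ)

theorem smul_mem_starGraph {r : ℝ} (hr : 0 < r) {x : Plane} (hx : r • x ∈ starGraph θ) :
    x ∈ starGraph θ := by
  simp only [starGraph, Set.mem_iUnion] at hx ⊢
  obtain ⟨j, s, hs, h⟩ := hx
  refine ⟨j, r⁻¹ * s, by positivity, ?_⟩
  rw [mul_smul, ← h, inv_smul_smul₀ hr.ne']

/-- A star graph is a null cone, so its complement contains arbitrarily large balls. -/
theorem exists_closedBall_subset_compl (R : ℝ) (hR : 0 < R) :
    ∃ y : Plane, Metric.closedBall y R ⊆ (starGraph θ)ᶜ := by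
  obtain ⟨x, hx⟩ : ∃ x : Plane, x ∈ (starGraph θ)ᶜ := (ae_mem_compl_starGraph θ).exists
  obtain ⟨ε, hε, hb⟩ := Metric.nhds_basis_closedBall.mem_iff.1
    ((isClosed_starGraph θ).isOpen_compl.mem_nhds hx)
  refine ⟨(R / ε) • x, fun z hz hzΓ => ?_⟩
  have hr : 0 < ε / R := by positivity
  have h1 : (ε / R) • z ∈ Metric.closedBall x ε := by
    rw [Metric.mem_closedBall, dist_eq_norm] at hz ⊢
    have : (ε / R) • z - x = (ε / R) • (z - (R / ε) • x) := by
      rw [smul_sub, smul_smul]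
      have : ε / R * (R / ε) = 1 := by field_simp
      rw [this, one_smul]
    rw [this, norm_smul, Real.norm_of_nonneg hr.le]
    calc ε / R * ‖z - (R / ε) • x‖ ≤ ε / R * R := by gcongr
      _ = ε := by field_simp
  refine hb h1 (smul_mem_starGraph θ (r := R / ε) (by positivity) ?_)
  rwa [smul_smul, show R / ε * (ε / R) = 1 by field_simp, one_smul]

/-- The linear coordinates `(s, τ) ↦ s e + τ (κ e + ε n)` attached to the half-line with direction
`e` and normal `n`. -/
def oblique (ϑ κ : ℝ) {ε : ℝ} (hε : ε ≠ 0) : (ℝ × ℝ) ≃L[ℝ] Plane :=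
  LinearEquiv.toContinuousLinearEquiv
    { toFun := fun z => z.1 • direction ϑ + z.2 • (κ • direction ϑ + ε • normal ϑ)
      map_add' := fun z w => by simp only [Prod.fst_add, Prod.snd_add, add_smul]; abel
      map_smul' := fun c z => by
        simp only [Prod.smul_fst, Prod.smul_snd, smul_eq_mul, mul_smul, RingHom.id_apply, smul_add]
      invFun := fun x =>
        (Real.cos ϑ * x 0 + Real.sin ϑ * x 1 - κ / ε * (-Real.sin ϑ * x 0 + Real.cos ϑ * x 1),
          (-Real.sin ϑ * x 0 + Real.cos ϑ * x 1) / ε)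
      left_inv := fun z => by
        have hsc := Real.sin_sq_add_cos_sq ϑ
        have e : -(Real.sin ϑ *
            (z.1 * Real.cos ϑ + (z.2 * (κ * Real.cos ϑ) + -(z.2 * (ε * Real.sin ϑ)))))
            + Real.cos ϑ * (z.1 * Real.sin ϑ + (z.2 * (κ * Real.sin ϑ) + z.2 * (ε * Real.cos ϑ)))
            = ε * z.2 := by
          linear_combination (ε * z.2) * hsc
        ext
        · simp [direction, normal]
          rw [e]
          field_simp
          linear_combination (z.1 + z.2 * κ) * hsc
        · simp [direction, normal]
          rw [e]
          field_simp
      right_inv := fun x => by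
        have hsc := Real.sin_sq_add_cos_sq ϑ
        ext i
        fin_cases i
        · simp [direction, normal]
          field_simp
          linear_combination ε * x 0 * hsc
        · simp [direction, normal]
          field_simp
          linear_combination ε * x 1 * hsc }

theorem oblique_apply (ϑ κ : ℝ) {ε : ℝ} (hε : ε ≠ 0) (z : ℝ × ℝ) :
    oblique ϑ κ hε z = z.1 • direction ϑ + z.2 • (κ • direction ϑ + ε • normal ϑ) := rfl

/-- In linear coordinates the area changes by a constant factor. -/
theorem exists_map_volume_eq (A : (ℝ × ℝ) ≃L[ℝ] Plane) :
    ∃ c : NNReal, Measure.map A volume = c • (volume : Measure Plane) := by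
  have : (Measure.map A (volume : Measure (ℝ × ℝ))).IsAddHaarMeasure :=
    A.isAddHaarMeasure_map _
  exact ⟨_, Measure.isAddLeftInvariant_eq_smul _ _⟩

theorem quasiMeasurePreserving_coord (A : (ℝ × ℝ) ≃L[ℝ] Plane) :
    Measure.QuasiMeasurePreserving A volume volume := by
  obtain ⟨c, h⟩ := exists_map_volume_eq A
  refine ⟨A.continuous.measurable, ?_⟩
  rw [h]
  exact Measure.smul_absolutelyContinuous

theorem exists_lintegral_comp_eq (A : (ℝ × ℝ) ≃L[ℝ] Plane) : ∃ c : NNReal,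
    ∀ f : Plane → ENNReal, Measurable f → ∫⁻ z, f (A z) = c * ∫⁻ x, f x := by
  obtain ⟨c, h⟩ := exists_map_volume_eq A
  refine ⟨c, fun f hf => ?_⟩
  rw [← lintegral_map hf A.continuous.measurable, h, lintegral_smul_measure]
  rfl

theorem memLp_comp_coord (A : (ℝ × ℝ) ≃L[ℝ] Plane) {f : Plane → ℂ} (hf : MemLp f 2 volume) :
    MemLp (fun z => f (A z)) 2 volume := by
  obtain ⟨c, h⟩ := exists_map_volume_eq A
  refine MemLp.comp_of_map (g := f) ?_ A.continuous.measurable.aemeasurable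
  rw [h]
  exact hf.smul_measure ENNReal.coe_ne_top

/-- A sufficiently thin sector around a branch, cut along the branch, does not meet the graph. -/
theorem exists_sector_disjoint (ϑ : ℝ) : ∃ κ : ℝ, ∀ s τ ε : ℝ, 0 < s → 0 < τ → |ε| = 1 →
    s • direction ϑ + τ • (κ • direction ϑ + ε • normal ϑ) ∉ starGraph θ := by
  -- `κ` bounds the cotangents of the angles to all branches; branches parallel to the half-line
  -- contribute `x / 0 = 0` and are excluded by the transversal component instead.
  refine ⟨∑ j, |Real.cos (θ j - ϑ) / Real.sin (θ j - ϑ)|, fun s τ ε hs hτ hε hΓ => ?_⟩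
  set κ := ∑ j, |Real.cos (θ j - ϑ) / Real.sin (θ j - ϑ)| with hκ
  simp only [starGraph, Set.mem_iUnion] at hΓ
  obtain ⟨j, r, hr, h⟩ := hΓ
  have hκj : |Real.cos (θ j - ϑ) / Real.sin (θ j - ϑ)| ≤ κ :=
    Finset.single_le_sum (f := fun j => |Real.cos (θ j - ϑ) / Real.sin (θ j - ϑ)|)
      (fun _ _ => abs_nonneg _) (Finset.mem_univ j)
  have h0 := congrArg (fun x : Plane => x 0) h
  have h1 := congrArg (fun x : Plane => x 1) h
  simp [direction, normal] at h0 h1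
  have hsc := Real.sin_sq_add_cos_sq ϑ
  have e1 : s + τ * κ = r * Real.cos (θ j - ϑ) := by
    rw [Real.cos_sub]
    linear_combination Real.cos ϑ * h0 + Real.sin ϑ * h1 - (s + τ * κ) * hsc
  have e2 : τ * ε = r * Real.sin (θ j - ϑ) := by
    rw [Real.sin_sub]
    linear_combination (-Real.sin ϑ) * h0 + Real.cos ϑ * h1 - τ * ε * hsc
  have hε0 : ε ≠ 0 := by rintro rfl; simp at hε
  have hsin : Real.sin (θ j - ϑ) ≠ 0 := by
    intro h
    rw [h, mul_zero] at e2
    exact mul_ne_zero hτ.ne' hε0 e2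
  have e3 : τ = r * |Real.sin (θ j - ϑ)| := by
    have := congrArg abs e2
    rwa [abs_mul, abs_mul, hε, mul_one, abs_of_pos hτ, abs_of_nonneg hr] at this
  have e4 : r * Real.cos (θ j - ϑ) ≤ τ * κ := by
    calc r * Real.cos (θ j - ϑ) ≤ r * |Real.cos (θ j - ϑ)| := by gcongr; exact le_abs_self _
      _ = τ * |Real.cos (θ j - ϑ) / Real.sin (θ j - ϑ)| := by
        rw [abs_div, e3]
        have := abs_pos.2 hsin
        field_simp
      _ ≤ τ * κ := by gcongr
  linarith

end Geometry

/-! ### Weak derivatives and the fundamental theorem of calculus on lines -/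

section Translation

variable {E : Type*} [NormedAddCommGroup E] [NormedSpace ℝ E] [FiniteDimensional ℝ E]
  [MeasurableSpace E] [BorelSpace E] {μ : Measure E} [μ.IsAddHaarMeasure]

/-- The shear `(σ, x) ↦ (σ, x + σ q)` preserves product measures. -/
theorem measurePreserving_shear (ν : Measure ℝ) [SFinite ν] (q : E) :
    MeasurePreserving (fun z : ℝ × E => (z.1, z.2 + z.1 • q)) (ν.prod μ) (ν.prod μ) :=
  (MeasurePreserving.id ν).skew_product (g := fun σ x => x + σ • q)
    (by fun_prop) (Eventually.of_forall fun σ => (measurePreserving_add_right μ (σ • q)).map_eq)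

theorem memLp_comp_shear {f : E → ℂ} (hf : MemLp f 2 μ) (ν : Measure ℝ) [IsFiniteMeasure ν]
    (q : E) : MemLp (fun z : ℝ × E => f (z.2 + z.1 • q)) 2 (ν.prod μ) :=
  (hf.comp_snd ν).comp_measurePreserving (measurePreserving_shear ν q)

/-- A function with a square integrable weak derivative along `q` satisfies the fundamental theorem
of calculus along almost all half-lines of direction `q`. -/
theorem ae_sub_eq_integral_of_weak_deriv {K : Set E} (hK : IsOpen K) {q : E}
    (hKq : ∀ x ∈ K, ∀ σ : ℝ, 0 ≤ σ → x + σ • q ∈ K) {u w : E → ℂ} (hu : MemLp u 2 μ)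
    (hw : MemLp w 2 μ)
    (h : ∀ φ : E → ℂ, ContDiff ℝ ∞ φ → HasCompactSupport φ → tsupport φ ⊆ K →
      ∫ x, u x * fderiv ℝ φ x q ∂μ = -∫ x, w x * φ x ∂μ) {t : ℝ} (ht : 0 ≤ t) :
    ∀ᵐ x ∂μ, x ∈ K → u (x + t • q) - u x - ∫ σ in Set.Ioc 0 t, w (x + σ • q) = 0 := by
  set ν : Measure ℝ := volume.restrict (Set.Ioc 0 t) with hν
  have hut : MemLp (fun x => u (x + t • q)) 2 μ :=
    hu.comp_measurePreserving (measurePreserving_add_right μ (t • q))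
  have hwS := memLp_comp_shear hw ν q
  refine hK.ae_eq_zero_of_integral_contDiff_smul_eq_zero ?_ ?_
  · refine LocallyIntegrable.locallyIntegrableOn ?_ _
    refine ((hut.locallyIntegrable one_le_two).sub (hu.locallyIntegrable one_le_two)).sub ?_
    rw [locallyIntegrable_iff]
    intro k hk
    have : IsFiniteMeasure (μ.restrict k) := ⟨by simpa using hk.measure_lt_top⟩
    have h1 : MemLp (fun z : ℝ × E => w (z.2 + z.1 • q)) 2 (ν.prod (μ.restrict k)) := by
      refine hwS.mono_measure ?_
      exact Measure.prod_mono le_rfl Measure.restrict_le_self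
    exact (h1.integrable one_le_two).integral_prod_right
  · intro g hg hgc hgK
    set φ : E → ℂ := fun x => (g x : ℂ) with hφ
    have hφs : ContDiff ℝ ∞ φ := Complex.ofRealCLM.contDiff.comp hg
    have hφc : HasCompactSupport φ := hgc.comp_left (g := fun r : ℝ => (r : ℂ)) (by simp)
    have hφK : tsupport φ ⊆ K := by
      refine (closure_mono ?_).trans hgK
      intro x hx
      simp only [hφ, Function.mem_support, ne_eq, Complex.ofReal_eq_zero] at hx ⊢
      exact hx
    have hφL : MemLp φ 2 μ := hφs.continuous.memLp_of_hasCompactSupport hφc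
    set ψ : E → ℂ := fun x => fderiv ℝ φ x q with hψ
    have hψcont : Continuous ψ := (hφs.continuous_fderiv (by simp)).clm_apply continuous_const
    have hψc : HasCompactSupport ψ := hφc.fderiv_apply ℝ q
    have hψL : MemLp ψ 2 μ := hψcont.memLp_of_hasCompactSupport hψc
    have hφt : MemLp (fun x => φ (x - t • q)) 2 μ :=
      hφL.comp_measurePreserving (measurePreserving_sub_right μ (t • q))
    -- For `σ ≥ 0` the translate `φ (· - σ q)` is supported in `K` too, so it is a test function.
    have hder : ∀ σ : ℝ, 0 ≤ σ → ∫ x, u x * ψ (x - σ • q) ∂μ = -∫ x, w (x + σ • q) * φ x ∂μ := by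
      intro σ hσ
      have := h (fun x => φ (x - σ • q)) (hφs.comp (contDiff_id.sub contDiff_const))
        (hφc.comp_homeomorph (Homeomorph.subRight (σ • q))) ?_
      · have e1 : ∀ x, fderiv ℝ (fun x => φ (x - σ • q)) x = fderiv ℝ φ (x - σ • q) := fun x => by
          rw [fderiv_comp_sub]
        simp only [e1] at this
        rw [show (∫ x, u x * ψ (x - σ • q) ∂μ) = _ from this]
        congr 1
        rw [← integral_add_right_eq_self _ (σ • q)]
        simp
      · have : tsupport (fun x => φ (x - σ • q)) = (Homeomorph.subRight (σ • q)) ⁻¹' tsupport φ :=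
          (tsupport_comp_eq_preimage φ (Homeomorph.subRight (σ • q)))
        rw [this]
        intro x hx
        have := hKq _ (hφK hx) σ hσ
        simpa using this
    have hftc : ∀ x, φ (x - t • q) - φ x = -∫ σ, ψ (x - σ • q) ∂ν := by
      intro x
      have hd : ∀ σ : ℝ, HasDerivAt (fun σ : ℝ => φ (x - σ • q)) (-ψ (x - σ • q)) σ := by
        intro σ
        have h1 : HasDerivAt (fun σ : ℝ => x - σ • q) (-q) σ := by
          simpa using ((hasDerivAt_id σ).smul_const q).const_sub x
        have h2 := (((hφs.differentiable (by simp)) (x - σ • q)).hasFDerivAt).comp_hasDerivAt σ h1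
        rw [map_neg] at h2
        exact h2
      have := intervalIntegral.integral_eq_sub_of_hasDerivAt (a := 0) (b := t)
        (fun σ _ => hd σ) (Continuous.intervalIntegrable (by fun_prop) _ _)
      rw [intervalIntegral.integral_of_le ht, integral_neg] at this
      simpa using this.symm
    have hgφ : ∀ x, ∀ z : ℂ, g x • z = φ x * z := fun x z => by simp [hφ]
    simp only [hgφ]
    have i1 : Integrable (fun x => φ x * u (x + t • q)) μ := hut.integrable_mul hφL |>.congr
      (Eventually.of_forall fun x => by simp [mul_comm])
    have i2 : Integrable (fun x => φ x * u x) μ := hu.integrable_mul hφL |>.congr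
      (Eventually.of_forall fun x => by simp [mul_comm])
    have i2' : Integrable (fun x => φ (x - t • q) * u x) μ := hu.integrable_mul hφt |>.congr
      (Eventually.of_forall fun x => by simp [mul_comm])
    have i3 : Integrable (Function.uncurry fun (σ : ℝ) (x : E) => w (x + σ • q) * φ x)
      (ν.prod μ) := hwS.integrable_mul (hφL.comp_snd ν)
    have i4 : Integrable (Function.uncurry fun (x : E) (σ : ℝ) => u x * ψ (x - σ • q))
        (μ.prod ν) := by
      have : Integrable (Function.uncurry fun (σ : ℝ) (x : E) => u x * ψ (x - σ • q))
          (ν.prod μ) := by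
        have h3 := memLp_comp_shear hψL ν (-q)
        refine ((hu.comp_snd ν).integrable_mul h3).congr (Eventually.of_forall fun z => ?_)
        simp [Function.uncurry, sub_eq_add_neg]
      exact this.swap
    have i5 : Integrable (fun x => φ x * ∫ σ, w (x + σ • q) ∂ν) μ := by
      refine i3.integral_prod_right.congr (Eventually.of_forall fun x => ?_)
      simp only [Function.uncurry]
      rw [integral_mul_const, mul_comm]
    -- By Fubini's theorem both sides are pairings of `w` with the translates of `φ`.
    have key : ∫ x, φ x * u (x + t • q) ∂μ - ∫ x, φ x * u x ∂μ
        = ∫ x, φ x * ∫ σ, w (x + σ • q) ∂ν ∂μ := by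
      have s1 : ∫ x, φ x * u (x + t • q) ∂μ = ∫ x, φ (x - t • q) * u x ∂μ := by
        rw [← integral_add_right_eq_self (fun x => φ (x - t • q) * u x) (t • q)]
        simp
      rw [s1, ← integral_sub i2' i2]
      have s2 : ∀ x, φ (x - t • q) * u x - φ x * u x = -∫ σ, u x * ψ (x - σ • q) ∂ν := by
        intro x
        rw [← sub_mul, hftc, integral_const_mul]; ring
      simp only [s2]
      rw [integral_neg, integral_integral_swap i4]
      have s3 : ∫ σ, ∫ x, u x * ψ (x - σ • q) ∂μ ∂ν = ∫ σ, -∫ x, w (x + σ • q) * φ x ∂μ ∂ν := by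
        refine setIntegral_congr_fun measurableSet_Ioc fun σ hσ => ?_
        exact hder σ hσ.1.le
      rw [s3, integral_neg, neg_neg, integral_integral_swap i3]
      refine integral_congr_ae (Eventually.of_forall fun x => ?_)
      simp only
      rw [integral_mul_const, mul_comm]
    simp only [mul_sub]
    rw [integral_sub _ i5, integral_sub i1 i2, key, sub_self]
    exact i1.sub i2

end Translation

section Trace

variable {U W : ℝ × ℝ → ℂ}

theorem measurable_primitive (hW : Measurable W) :
    Measurable fun x : ℝ × ℝ => ∫ σ in Set.Ioc 0 x.2, W (x.1, σ) := by
  have : ∀ x : ℝ × ℝ, ∫ σ in Set.Ioc 0 x.2, W (x.1, σ)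
      = ∫ σ, {z : (ℝ × ℝ) × ℝ | 0 < z.2 ∧ z.2 ≤ z.1.2}.indicator
          (fun z => W (z.1.1, z.2)) (x, σ) := by
    intro x
    rw [← integral_indicator measurableSet_Ioc]
    rfl
  simp only [this]
  refine (StronglyMeasurable.integral_prod_right' (Measurable.stronglyMeasurable ?_)).measurable
  refine Measurable.indicator (by fun_prop) ?_
  exact (measurableSet_lt measurable_const measurable_snd).inter
    (measurableSet_le measurable_snd (by fun_prop))

theorem ae_memLp_slice (hW : MemLp W 2 volume) :
    ∀ᵐ s : ℝ, MemLp (fun σ => W (s, σ)) 2 volume := by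
  have h1 := hW.integrable_norm_pow two_ne_zero
  have h2 := Integrable.prod_right_ae (μ := volume) (ν := volume) h1
  have h3 := hW.1.prodMk_left (μ := volume) (ν := volume)
  filter_upwards [h2, h3] with s h2 h3
  exact (memLp_two_iff_integrable_sq_norm h3).2 h2

/-- If the increments of `U` in the second variable are, for each step `t`, almost everywhere the
integrals of `W`, then `U` has a trace on the first axis. The point is to pass from one null set for
each step to one null set for almost all lines: the functions `U (·, τ) - ∫ σ in 0..τ, W (·, σ)`
agree for almost all pairs of levels, and any two levels are compared through a third one. -/
theorem exists_trace (hUm : Measurable U) (hWm : Measurable W) (hW : MemLp W 2 volume)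
    (h : ∀ t : ℝ, 0 ≤ t → ∀ᵐ x : ℝ × ℝ, 0 < x.1 → 0 < x.2 →
      U (x.1, x.2 + t) - U x - ∫ σ in Set.Ioc 0 t, W (x.1, x.2 + σ) = 0) :
    ∃ g : ℝ → ℂ, Measurable g ∧ ∀ᵐ τ : ℝ, 0 < τ → ∀ᵐ s : ℝ, 0 < s →
      U (s, τ) = g s + ∫ σ in Set.Ioc 0 τ, W (s, σ) := by
  set k : ℝ × ℝ → ℂ := fun x => U x - ∫ σ in Set.Ioc 0 x.2, W (x.1, σ) with hk
  have hkm : Measurable k := hUm.sub (measurable_primitive hWm)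
  -- For each step `t`, the function `k` does not change under `τ ↦ τ + t`.
  have step : ∀ t : ℝ, ∀ᵐ τ : ℝ, ∀ᵐ s : ℝ, 0 < s → 0 < τ → 0 < t → k (s, τ + t) = k (s, τ) := by
    intro t
    by_cases ht : 0 < t
    swap
    · exact Eventually.of_forall fun τ => Eventually.of_forall fun s _ _ h => absurd h ht
    have h1 : ∀ᵐ x : ℝ × ℝ, 0 < x.2 → 0 < x.1 →
        U (x.2, x.1 + t) - U (x.2, x.1) - ∫ σ in Set.Ioc 0 t, W (x.2, x.1 + σ) = 0 := by
      have := (Measure.measurePreserving_swap (μ := (volume : Measure ℝ))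
        (ν := (volume : Measure ℝ))).quasiMeasurePreserving.ae (h t ht.le)
      exact this
    filter_upwards [Measure.ae_ae_of_ae_prod h1] with τ h2
    filter_upwards [h2, ae_memLp_slice hW] with s h3 h4 hs hτ _
    have h5 := h3 hs hτ
    have hint : ∀ a b : ℝ, IntervalIntegrable (fun σ => W (s, σ)) volume a b := fun a b =>
      ((h4.locallyIntegrable one_le_two).integrableOn_isCompact isCompact_uIcc).intervalIntegrable
    simp only [hk]
    rw [← intervalIntegral.integral_of_le ht.le] at h5
    rw [← intervalIntegral.integral_of_le hτ.le, ← intervalIntegral.integral_of_le (by linarith),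
      ← intervalIntegral.integral_add_adjacent_intervals (hint 0 τ) (hint τ (τ + t))]
    rw [intervalIntegral.integral_comp_add_left (fun σ => W (s, σ)) τ, add_zero] at h5
    linear_combination h5
  have hmeas : MeasurableSet {x : ℝ × ℝ | ∀ᵐ s : ℝ, 0 < s → 0 < x.2 → 0 < x.1 →
      k (s, x.2 + x.1) = k (s, x.2)} := by
    have hS : MeasurableSet {z : (ℝ × ℝ) × ℝ | ¬ (0 < z.2 → 0 < z.1.2 → 0 < z.1.1 →
        k (z.2, z.1.2 + z.1.1) = k (z.2, z.1.2))} := by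
      have a1 : MeasurableSet {z : (ℝ × ℝ) × ℝ | 0 < z.2} :=
        measurableSet_lt measurable_const (by fun_prop)
      have a2 : MeasurableSet {z : (ℝ × ℝ) × ℝ | 0 < z.1.2} :=
        measurableSet_lt measurable_const (by fun_prop)
      have a3 : MeasurableSet {z : (ℝ × ℝ) × ℝ | 0 < z.1.1} :=
        measurableSet_lt measurable_const (by fun_prop)
      have a4 : MeasurableSet {z : (ℝ × ℝ) × ℝ | k (z.2, z.1.2 + z.1.1) = k (z.2, z.1.2)} :=
        measurableSet_eq_fun (by fun_prop) (by fun_prop)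
      exact (a1.imp (a2.imp (a3.imp a4))).compl
    have := measurable_measure_prodMk_left (ν := (volume : Measure ℝ)) hS
    exact this (measurableSet_singleton 0)
  -- Exchanging the quantifiers: from almost every level, almost every step leaves `k` unchanged.
  have step' := (Measure.ae_ae_comm (μ := (volume : Measure ℝ)) (ν := (volume : Measure ℝ))
    (p := fun t τ => ∀ᵐ s : ℝ, 0 < s → 0 < τ → 0 < t → k (s, τ + t) = k (s, τ)) hmeas).1
    (Eventually.of_forall step)
  have shift : ∀ᵐ τ : ℝ, 0 < τ → ∀ᵐ τ' : ℝ, τ < τ' → ∀ᵐ s : ℝ, 0 < s → k (s, τ') = k (s, τ) := by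
    filter_upwards [step'] with τ h1 hτ
    have := (measurePreserving_sub_right volume τ).quasiMeasurePreserving.ae h1
    filter_upwards [this] with τ' h2 hlt
    filter_upwards [h2] with s h3 hs
    simpa using h3 hs hτ (by linarith)
  obtain ⟨τ₁, hτ₁, h₁⟩ : ∃ τ₁ : ℝ, 0 < τ₁ ∧
      ∀ᵐ τ' : ℝ, τ₁ < τ' → ∀ᵐ s : ℝ, 0 < s → k (s, τ') = k (s, τ₁) := by
    have : ∃ᵐ τ : ℝ, 0 < τ := by
      rw [frequently_ae_iff]
      change volume (Set.Ioi (0 : ℝ)) ≠ 0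
      simp
    obtain ⟨τ, h1, h2⟩ := (this.and_eventually shift).exists
    exact ⟨τ, h1, h2 h1⟩
  refine ⟨fun s => k (s, τ₁), by fun_prop, ?_⟩
  filter_upwards [shift] with τ hτs hτ
  have : ∃ᵐ τ' : ℝ, max τ τ₁ < τ' := by
    rw [frequently_ae_iff]
    change volume (Set.Ioi (max τ τ₁)) ≠ 0
    simp
  obtain ⟨τ', hlt, h2, h3⟩ := (this.and_eventually ((hτs hτ).and h₁)).exists
  filter_upwards [h2 ((le_max_left _ _).trans_lt hlt), h3 ((le_max_right _ _).trans_lt hlt)]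
    with s h4 h5 hs
  have := (h4 hs).symm.trans (h5 hs)
  simp only [hk] at this ⊢
  linear_combination this

end Trace

/-! ### Norm estimates for traces -/

section TraceEstimates

theorem ennreal_add_sq_le (a b : ENNReal) : (a + b) ^ 2 ≤ 2 * a ^ 2 + 2 * b ^ 2 := by
  have := ENNReal.rpow_add_le_mul_rpow_add_rpow a b (p := 2) (by norm_num)
  rw [← mul_add]
  norm_num at this
  exact_mod_cast this

theorem enorm_add_sq_le (a b : ℂ) : ‖a + b‖ₑ ^ 2 ≤ 2 * ‖a‖ₑ ^ 2 + 2 * ‖b‖ₑ ^ 2 :=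
  (pow_le_pow_left' (enorm_add_le a b) 2).trans (ennreal_add_sq_le _ _)

theorem enorm_sub_sq_le (a b : ℂ) : ‖a - b‖ₑ ^ 2 ≤ 2 * ‖a‖ₑ ^ 2 + 2 * ‖b‖ₑ ^ 2 :=
  (pow_le_pow_left' enorm_sub_le 2).trans (ennreal_add_sq_le _ _)

theorem lintegral_enorm_sq_eq {α : Type*} [MeasurableSpace α] {μ : Measure α} (f : α → ℂ) :
    ∫⁻ x, ‖f x‖ₑ ^ 2 ∂μ = eLpNorm f 2 μ ^ 2 := by
  rw [eLpNorm_eq_lintegral_rpow_enorm_toReal two_ne_zero ENNReal.ofNat_ne_top]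
  simp only [ENNReal.toReal_ofNat, ENNReal.rpow_ofNat, one_div]
  rw [← ENNReal.rpow_natCast, ← ENNReal.rpow_mul]
  norm_num

theorem enorm_integral_sq_le {α : Type*} [MeasurableSpace α] (μ : Measure α) {f : α → ℂ}
    (hf : AEStronglyMeasurable f μ) :
    ‖∫ x, f x ∂μ‖ₑ ^ 2 ≤ μ Set.univ * ∫⁻ x, ‖f x‖ₑ ^ 2 ∂μ := by
  have h1 : ‖∫ x, f x ∂μ‖ₑ ≤ eLpNorm f 2 μ * μ Set.univ ^ (1 / 2 : ℝ) := by
    refine (enorm_integral_le_lintegral_enorm f).trans ?_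
    rw [← eLpNorm_one_eq_lintegral_enorm]
    have := eLpNorm_le_eLpNorm_mul_rpow_measure_univ (p := 1) (q := 2) one_le_two hf
    norm_num at this ⊢
    exact this
  refine (pow_le_pow_left' h1 2).trans ?_
  rw [mul_pow, lintegral_enorm_sq_eq, ← ENNReal.rpow_natCast (_ ^ (1 / 2 : ℝ)), ← ENNReal.rpow_mul,
    mul_comm]
  norm_num

variable {U W : ℝ × ℝ → ℂ} {g : ℝ → ℂ}

theorem lintegral_sub_trace_le (hWm : Measurable W)
    (h : ∀ᵐ τ : ℝ, 0 < τ → ∀ᵐ s : ℝ, 0 < s →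
      U (s, τ) = g s + ∫ σ in Set.Ioc 0 τ, W (s, σ)) :
    ∀ᵐ τ : ℝ, 0 < τ → ∫⁻ s in Set.Ioi 0, ‖U (s, τ) - g s‖ₑ ^ 2
      ≤ ENNReal.ofReal τ * ∫⁻ x, ‖W x‖ₑ ^ 2 := by
  filter_upwards [h] with τ h1 hτ
  calc ∫⁻ s in Set.Ioi 0, ‖U (s, τ) - g s‖ₑ ^ 2
      ≤ ∫⁻ s in Set.Ioi 0, ENNReal.ofReal τ * ∫⁻ σ, ‖W (s, σ)‖ₑ ^ 2 := by
        refine lintegral_mono_ae ((ae_restrict_iff' measurableSet_Ioi).2 ?_)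
        filter_upwards [h1 hτ] with s h2 hs
        rw [h2 hs, add_sub_cancel_left]
        refine (enorm_integral_sq_le _
          (by fun_prop : Measurable fun σ => W (s, σ)).aestronglyMeasurable).trans ?_
        rw [Measure.restrict_apply_univ, Real.volume_Ioc, sub_zero]
        gcongr
        exact Measure.restrict_le_self
    _ ≤ ∫⁻ s, ENNReal.ofReal τ * ∫⁻ σ, ‖W (s, σ)‖ₑ ^ 2 := setLIntegral_le_lintegral _ _
    _ = ENNReal.ofReal τ * ∫⁻ x, ‖W x‖ₑ ^ 2 := by
        rw [lintegral_const_mul', Measure.volume_eq_prod, lintegral_prod]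
        · exact (hWm.enorm.pow_const 2).aemeasurable
        · simp

theorem lintegral_trace_le (hUm : Measurable U) (hWm : Measurable W)
    (h : ∀ᵐ τ : ℝ, 0 < τ → ∀ᵐ s : ℝ, 0 < s →
      U (s, τ) = g s + ∫ σ in Set.Ioc 0 τ, W (s, σ)) :
    ∫⁻ s in Set.Ioi 0, ‖g s‖ₑ ^ 2 ≤ 2 * (∫⁻ x, ‖U x‖ₑ ^ 2) + 2 * ∫⁻ x, ‖W x‖ₑ ^ 2 := by
  have h1 : ∀ᵐ τ : ℝ, τ ∈ Set.Ioc (0 : ℝ) 1 → ∫⁻ s in Set.Ioi 0, ‖g s‖ₑ ^ 2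
      ≤ 2 * (∫⁻ s, ‖U (s, τ)‖ₑ ^ 2) + 2 * ∫⁻ x, ‖W x‖ₑ ^ 2 := by
    filter_upwards [lintegral_sub_trace_le hWm h] with τ h2 hτ
    calc ∫⁻ s in Set.Ioi 0, ‖g s‖ₑ ^ 2
        ≤ ∫⁻ s in Set.Ioi 0, (2 * ‖U (s, τ)‖ₑ ^ 2 + 2 * ‖U (s, τ) - g s‖ₑ ^ 2) := by
          refine lintegral_mono fun s => ?_
          simpa using enorm_sub_sq_le (U (s, τ)) (U (s, τ) - g s)
      _ = 2 * (∫⁻ s in Set.Ioi 0, ‖U (s, τ)‖ₑ ^ 2)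
          + 2 * ∫⁻ s in Set.Ioi 0, ‖U (s, τ) - g s‖ₑ ^ 2 := by
          rw [lintegral_add_left (by fun_prop), lintegral_const_mul' _ _ (by simp),
            lintegral_const_mul' _ _ (by simp)]
      _ ≤ _ := by
          gcongr
          · exact Measure.restrict_le_self
          · refine (h2 hτ.1).trans ?_
            calc _ ≤ 1 * ∫⁻ x, ‖W x‖ₑ ^ 2 := by
                  gcongr
                  exact ENNReal.ofReal_le_one.2 hτ.2
              _ = _ := one_mul _
  calc ∫⁻ s in Set.Ioi 0, ‖g s‖ₑ ^ 2
      = ∫⁻ _ in Set.Ioc (0 : ℝ) 1, ∫⁻ s in Set.Ioi 0, ‖g s‖ₑ ^ 2 := by simp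
    _ ≤ ∫⁻ τ in Set.Ioc (0 : ℝ) 1,
        (2 * (∫⁻ s, ‖U (s, τ)‖ₑ ^ 2) + 2 * ∫⁻ x, ‖W x‖ₑ ^ 2) :=
        lintegral_mono_ae ((ae_restrict_iff' measurableSet_Ioc).2 h1)
    _ = 2 * (∫⁻ τ in Set.Ioc (0 : ℝ) 1, ∫⁻ s, ‖U (s, τ)‖ₑ ^ 2)
        + 2 * ∫⁻ x, ‖W x‖ₑ ^ 2 := by
        rw [lintegral_add_right _ measurable_const, lintegral_const_mul' _ _ (by simp)]
        simp
    _ ≤ 2 * (∫⁻ τ, ∫⁻ s, ‖U (s, τ)‖ₑ ^ 2) + 2 * ∫⁻ x, ‖W x‖ₑ ^ 2 := by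
        gcongr
        exact Measure.restrict_le_self
    _ = _ := by
        rw [Measure.volume_eq_prod, lintegral_prod_symm (fun x => ‖U x‖ₑ ^ 2)]
        exact (hUm.enorm.pow_const 2).aemeasurable

/-- Continuity of translations in `L²`. -/
theorem tendsto_lintegral_translate {g : ℝ → ℂ} (hg : MemLp g 2 volume) :
    Tendsto (fun t : ℝ => ∫⁻ s, ‖g (s - t) - g s‖ₑ ^ 2) (𝓝 0) (𝓝 0) := by
  set G := hg.toLp g with hG
  let F : C(ℝ, C(ℝ, ℝ)) := (ContinuousMap.mk (fun a : ℝ × ℝ => a.2 - a.1) (by fun_prop)).curry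
  have hF : ∀ t, MeasurePreserving (F t) volume volume := fun t =>
    measurePreserving_sub_right volume t
  have hc : Continuous fun t : ℝ => Lp.compMeasurePreserving (F t) (hF t) G :=
    continuous_const.compMeasurePreservingLp F.continuous hF ENNReal.ofNat_ne_top
  have h0 := hc.tendsto 0
  rw [Lp.tendsto_Lp_iff_tendsto_eLpNorm'] at h0
  have h1 := ENNReal.Tendsto.pow (n := 2) h0
  simp only [ne_eq, OfNat.ofNat_ne_zero, not_false_eq_true, zero_pow] at h1
  refine h1.congr fun t => ?_
  rw [lintegral_enorm_sq_eq]
  congr 1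
  refine eLpNorm_congr_ae ?_
  have e : ∀ t, Lp.compMeasurePreserving (F t) (hF t) G =ᵐ[volume] fun s => g (s - t) := fun t =>
    (Lp.coeFn_compMeasurePreserving _ _).trans
      ((hF t).quasiMeasurePreserving.ae_eq_comp hg.coeFn_toLp)
  filter_upwards [e t, e 0] with s h2 h3
  rw [Pi.sub_apply, h2, h3, sub_zero]

end TraceEstimates

/-! ### One-sided traces on a half-line -/

section OneSidedTraces

theorem measurable_coe (u : L2Plane) : Measurable (u : Plane → ℂ) :=
  (Lp.stronglyMeasurable u).measurable

theorem enorm_sq_eq_lintegral {α : Type*} [MeasurableSpace α] {μ : Measure α} (u : Lp ℂ 2 μ) :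
    ‖u‖ₑ ^ 2 = ∫⁻ x, ‖u x‖ₑ ^ 2 ∂μ := by
  rw [lintegral_enorm_sq_eq, Lp.enorm_def]

theorem integrable_mul_test {u : L2Plane} {φ : Plane → ℂ} (hφ : Continuous φ)
    (hc : HasCompactSupport φ) : Integrable (fun x => u x * φ x) :=
  (Lp.memLp u).integrable_mul (q := 2) (hφ.memLp_of_hasCompactSupport hc)

/-- Weak partial derivatives combine to weak directional derivatives. -/
theorem HasWeakPartial.directional {Ω : Set Plane} {u : L2Plane} {w : Fin 2 → L2Plane}
    (h : ∀ i, HasWeakPartial Ω i u (w i)) (q : Plane) {φ : Plane → ℂ} (hφ : ContDiff ℝ ∞ φ)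
    (hc : HasCompactSupport φ) (hΩ : tsupport φ ⊆ Ω) :
    ∫ x, u x * fderiv ℝ φ x q = -∫ x, (∑ i, (q i : ℂ) • w i : L2Plane) x * φ x := by
  have hq : q = ∑ i, q i • EuclideanSpace.single i (1 : ℝ) := by
    ext j; fin_cases j <;> simp
  have hcont : ∀ i, Continuous (partialDeriv i φ) := fun i =>
    (hφ.continuous_fderiv (by simp)).clm_apply continuous_const
  have e1 : ∀ x, u x * fderiv ℝ φ x q = ∑ i, (q i : ℂ) * (u x * partialDeriv i φ x) := by
    intro x
    conv_lhs => rw [hq]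
    simp only [map_sum, map_smul, partialDeriv, Finset.mul_sum, Complex.real_smul]
    exact Finset.sum_congr rfl fun i _ => by ring
  have e2 : ∀ᵐ x, (∑ i, (q i : ℂ) • w i : L2Plane) x * φ x = ∑ i, (q i : ℂ) * (w i x * φ x) := by
    have h1 := Lp.coeFn_add ((q 0 : ℂ) • w 0) ((q 1 : ℂ) • w 1)
    filter_upwards [h1, Lp.coeFn_smul (q 0 : ℂ) (w 0), Lp.coeFn_smul (q 1 : ℂ) (w 1)]
      with x h1 h2 h3
    rw [Fin.sum_univ_two, h1, Pi.add_apply, h2, h3]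
    simp
    ring
  simp only [e1]
  rw [integral_congr_ae e2, integral_finsetSum, integral_finsetSum, ← Finset.sum_neg_distrib]
  · refine Finset.sum_congr rfl fun i _ => ?_
    rw [integral_const_mul, integral_const_mul, h i φ hφ hc hΩ, mul_neg]
  · exact fun i _ => (integrable_mul_test hφ.continuous hc).const_mul _
  · exact fun i _ => (integrable_mul_test (hcont i) (hc.fderiv_apply ℝ _)).const_mul _

variable {M : ℕ} (θ : Fin M → ℝ)

/-- The restrictions of `u ∈ H¹(ℝ² \ Γ)` to the lines parallel to a half-line, shifted along it so
as to stay in a sector of the complement, have a limit at this half-line. -/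
theorem exists_oblique_trace {ϑ κ ε : ℝ} (hε : |ε| = 1) (hε0 : ε ≠ 0)
    (hκ : ∀ s τ ε : ℝ, 0 < s → 0 < τ → |ε| = 1 →
      s • direction ϑ + τ • (κ • direction ϑ + ε • normal ϑ) ∉ starGraph θ) :
    ∃ c : NNReal, ∀ (u : L2Plane) (w : Fin 2 → L2Plane),
      (∀ i, HasWeakPartial (starGraph θ)ᶜ i u (w i)) →
      ∃ g : ℝ → ℂ, Measurable g ∧
        (∀ᵐ τ : ℝ, 0 < τ → ∫⁻ s in Set.Ioi 0, ‖u (oblique ϑ κ hε0 (s, τ)) - g s‖ₑ ^ 2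
          ≤ ENNReal.ofReal τ * (c * (‖w 0‖ₑ + ‖w 1‖ₑ) ^ 2)) ∧
        ∫⁻ s in Set.Ioi 0, ‖g s‖ₑ ^ 2 ≤ c * (‖u‖ₑ + ‖w 0‖ₑ + ‖w 1‖ₑ) ^ 2 := by
  set A := oblique ϑ κ hε0 with hA
  set q : Plane := κ • direction ϑ + ε • normal ϑ with hq
  obtain ⟨c, hc⟩ := exists_lintegral_comp_eq A
  refine ⟨4 * c * (1 + ‖q 0‖₊ + ‖q 1‖₊) ^ 2, fun u w huw => ?_⟩
  set W : L2Plane := ∑ i, (q i : ℂ) • w i with hW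
  set K : Set Plane := A '' (Set.Ioi 0 ×ˢ Set.Ioi 0) with hKdef
  have hKo : IsOpen K := A.toHomeomorph.isOpenMap _ (isOpen_Ioi.prod isOpen_Ioi)
  have hAadd : ∀ (s τ σ : ℝ), A (s, τ) + σ • q = A (s, τ + σ) := fun s τ σ => by
    simp only [hA, oblique_apply, add_smul, hq]; abel
  have hKq : ∀ x ∈ K, ∀ σ : ℝ, 0 ≤ σ → x + σ • q ∈ K := by
    rintro _ ⟨⟨s, τ⟩, ⟨hs, hτ⟩, rfl⟩ σ hσ
    rw [hAadd]
    exact ⟨(s, τ + σ), ⟨hs, add_pos_of_pos_of_nonneg hτ hσ⟩, rfl⟩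
  have hKΩ : K ⊆ (starGraph θ)ᶜ := by
    rintro _ ⟨⟨s, τ⟩, ⟨hs, hτ⟩, rfl⟩
    exact hκ s τ ε hs hτ hε
  have hUA : Measurable fun z => u (A z) := (measurable_coe u).comp A.continuous.measurable
  have hWA : Measurable fun z => W (A z) := (measurable_coe W).comp A.continuous.measurable
  obtain ⟨g, hgm, hg⟩ := exists_trace (U := fun z => u (A z)) (W := fun z => W (A z))
    hUA hWA (memLp_comp_coord A (Lp.memLp W)) (by
      intro t ht
      have h1 := ae_sub_eq_integral_of_weak_deriv hKo hKq (Lp.memLp u) (Lp.memLp W)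
        (fun φ h1 h2 h3 => HasWeakPartial.directional huw q h1 h2 (h3.trans hKΩ)) ht
      filter_upwards [(quasiMeasurePreserving_coord A).ae h1] with z hz h1 h2
      have := hz ⟨z, ⟨h1, h2⟩, rfl⟩
      simpa only [← hAadd] using this)
  have hWn : ‖W‖ₑ ≤ (1 + ‖q 0‖₊ + ‖q 1‖₊ : NNReal) * (‖w 0‖ₑ + ‖w 1‖ₑ) := by
    rw [hW, Fin.sum_univ_two]
    refine (enorm_add_le _ _).trans ?_
    rw [enorm_smul, enorm_smul, mul_add]
    have e : ∀ i, ‖(q i : ℂ)‖ₑ = (‖q i‖₊ : ENNReal) := fun i => by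
      rw [enorm_eq_nnnorm, Complex.nnnorm_real]
    rw [e, e]
    gcongr
    · calc ‖q 0‖₊ ≤ 1 + ‖q 0‖₊ := le_add_self
        _ ≤ _ := le_self_add
    · exact le_add_self
  have hl : ∀ v : L2Plane, ∫⁻ z, ‖v (A z)‖ₑ ^ 2 = c * ‖v‖ₑ ^ 2 := fun v => by
    rw [hc _ ((measurable_coe v).enorm.pow_const 2), enorm_sq_eq_lintegral]
  refine ⟨g, hgm, ?_, ?_⟩
  · have h1 := lintegral_sub_trace_le (U := fun z => u (A z)) (g := g) hWA hg
    filter_upwards [h1] with τ h2 hτ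
    refine (h2 hτ).trans ?_
    gcongr
    rw [hl]
    calc (c : ENNReal) * ‖W‖ₑ ^ 2
        ≤ c * ((1 + ‖q 0‖₊ + ‖q 1‖₊ : NNReal) * (‖w 0‖ₑ + ‖w 1‖ₑ)) ^ 2 := by gcongr
      _ = 1 * (c * (1 + ‖q 0‖₊ + ‖q 1‖₊ : NNReal) ^ 2 * (‖w 0‖ₑ + ‖w 1‖ₑ) ^ 2) := by ring
      _ ≤ 4 * (c * (1 + ‖q 0‖₊ + ‖q 1‖₊ : NNReal) ^ 2 * (‖w 0‖ₑ + ‖w 1‖ₑ) ^ 2) := by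
        gcongr; norm_num
      _ = _ := by push_cast; ring
  · have h1 := lintegral_trace_le hUA hWA hg
    refine h1.trans ?_
    rw [hl, hl]
    set N := ‖u‖ₑ + ‖w 0‖ₑ + ‖w 1‖ₑ with hN
    set m : NNReal := 1 + ‖q 0‖₊ + ‖q 1‖₊ with hm
    have b1 : ‖u‖ₑ ≤ m * N := by
      calc ‖u‖ₑ = 1 * ‖u‖ₑ := (one_mul _).symm
        _ ≤ m * N := by
          gcongr
          · rw [← ENNReal.coe_one, ENNReal.coe_le_coe, hm, add_assoc]; exact le_self_add
          · rw [hN, add_assoc]; exact le_self_add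
    have b2 : ‖W‖ₑ ≤ m * N := hWn.trans (by gcongr; rw [hN, add_assoc]; exact le_add_self)
    calc 2 * ((c : ENNReal) * ‖u‖ₑ ^ 2) + 2 * (c * ‖W‖ₑ ^ 2)
        ≤ 2 * (c * (m * N) ^ 2) + 2 * (c * (m * N) ^ 2) := by gcongr
      _ = _ := by push_cast; ring

/-- `g` is the trace of `u` on the half-line of polar angle `ϑ` from the side of `ε n`, in the sense
of `L²` limits on compact subintervals. -/
def IsTrace (ϑ ε : ℝ) (u : L2Plane) (g : L2Branch) : Prop :=
  ∀ a b : ℝ, 0 < a → a < b →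
    Tendsto (fun t : ℝ => ∫⁻ s in Set.Ioo a b,
        ‖u (s • direction ϑ + t • (ε • normal ϑ)) - g s‖ₑ ^ 2)
      (𝓝[>] (0 : ℝ) ⊓ ae volume) (𝓝 0)

/-- The one-sided trace theorem on `H¹(ℝ² \ Γ)`. -/
theorem exists_isTrace (ϑ : ℝ) {ε : ℝ} (hε : |ε| = 1) :
    ∃ c : NNReal, ∀ (u : L2Plane) (w : Fin 2 → L2Plane),
      (∀ i, HasWeakPartial (starGraph θ)ᶜ i u (w i)) →
      ∃ g : L2Branch, IsTrace ϑ ε u g ∧ ‖g‖ₑ ^ 2 ≤ c * (‖u‖ₑ + ‖w 0‖ₑ + ‖w 1‖ₑ) ^ 2 := by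
  obtain ⟨κ, hκ⟩ := exists_sector_disjoint θ ϑ
  have hε0 : ε ≠ 0 := by rintro rfl; simp at hε
  obtain ⟨c, hc⟩ := exists_oblique_trace θ hε hε0 hκ
  refine ⟨c, fun u w huw => ?_⟩
  obtain ⟨g, hgm, hg1, hg2⟩ := hc u w huw
  have hgL : MemLp g 2 (volume.restrict (Set.Ioi 0)) := by
    refine ⟨hgm.aestronglyMeasurable, ?_⟩
    have : eLpNorm g 2 (volume.restrict (Set.Ioi 0)) ^ 2 < ⊤ := by
      rw [← lintegral_enorm_sq_eq]
      exact hg2.trans_lt (by finiteness)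
    exact (ENNReal.pow_lt_top_iff.1 this).resolve_right two_ne_zero
  refine ⟨hgL.toLp g, ?_, ?_⟩
  swap
  · rw [Lp.enorm_toLp, ← lintegral_enorm_sq_eq]; exact hg2
  intro a b ha hab
  -- The oblique coordinates shift the line at height `t` by `κ t`; the error of this shift vanishes
  -- in the limit because translations are continuous in `L²`.
  set G : ℝ → ℂ := (Set.Ioi 0).indicator g with hG
  have hGm : Measurable G := hgm.indicator measurableSet_Ioi
  have hGL : MemLp G 2 volume := (memLp_indicator_iff_restrict measurableSet_Ioi).2 hgL
  set A := oblique ϑ κ hε0 with hA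
  have hAm : Measurable A := A.continuous.measurable
  have hum := measurable_coe u
  have hlim : Tendsto (fun t : ℝ => 2 * (ENNReal.ofReal t * (c * (‖w 0‖ₑ + ‖w 1‖ₑ) ^ 2))
      + 2 * ∫⁻ s, ‖G (s - κ * t) - G s‖ₑ ^ 2) (𝓝[>] (0 : ℝ) ⊓ ae volume) (𝓝 0) := by
    have l1 : Tendsto (fun t : ℝ => 2 * (ENNReal.ofReal t * (c * (‖w 0‖ₑ + ‖w 1‖ₑ) ^ 2)))
        (𝓝 0) (𝓝 0) := by
      have t1 : Tendsto ENNReal.ofReal (𝓝 (0 : ℝ)) (𝓝 0) := by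
        simpa using ENNReal.tendsto_ofReal (tendsto_id (x := 𝓝 (0 : ℝ)))
      have t2 := ENNReal.Tendsto.mul_const (b := (c * (‖w 0‖ₑ + ‖w 1‖ₑ) ^ 2)) t1
        (Or.inr (by finiteness))
      have t3 := ENNReal.Tendsto.const_mul (a := 2) t2 (Or.inr (by simp))
      simpa using t3
    have l2 : Tendsto (fun t : ℝ => 2 * ∫⁻ s, ‖G (s - κ * t) - G s‖ₑ ^ 2) (𝓝 0) (𝓝 0) := by
      have t0 : Tendsto (fun t : ℝ => κ * t) (𝓝 0) (𝓝 0) := by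
        simpa using (continuous_const_mul κ).tendsto (0 : ℝ)
      have t1 := (tendsto_lintegral_translate hGL).comp t0
      have t3 := ENNReal.Tendsto.const_mul (a := 2) t1 (Or.inr (by simp))
      simpa using t3
    have := (l1.add l2).mono_left
      ((inf_le_left : 𝓝[>] (0 : ℝ) ⊓ ae volume ≤ _).trans nhdsWithin_le_nhds)
    simpa using this
  refine tendsto_of_tendsto_of_tendsto_of_le_of_le' tendsto_const_nhds hlim
    (Eventually.of_forall fun _ => zero_le) ?_
  have ev1 : ∀ᶠ t in 𝓝[>] (0 : ℝ) ⊓ ae volume, 0 < t :=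
    Filter.Eventually.filter_mono inf_le_left self_mem_nhdsWithin
  have ev2 : ∀ᶠ t in 𝓝[>] (0 : ℝ) ⊓ ae volume, κ * t < a := by
    refine Filter.Eventually.filter_mono (inf_le_left.trans nhdsWithin_le_nhds) ?_
    have : Tendsto (fun t : ℝ => κ * t) (𝓝 0) (𝓝 0) := by
      simpa using (continuous_const_mul κ).tendsto (0 : ℝ)
    exact this.eventually_lt_const ha
  filter_upwards [ev1, ev2, Filter.Eventually.filter_mono inf_le_right hg1] with t ht0 hta ht
  set F : ℝ → ENNReal := (Set.Ioi 0).indicator fun s => ‖u (A (s, t)) - g s‖ₑ ^ 2 with hF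
  have hFm : Measurable F := by
    refine Measurable.indicator ?_ measurableSet_Ioi
    exact ((hum.comp (hAm.comp (by fun_prop))).sub hgm).enorm.pow_const 2
  have hpt : ∀ s : ℝ, s • direction ϑ + t • (ε • normal ϑ) = A (s - κ * t, t) := fun s => by
    simp only [hA, oblique_apply, sub_smul, smul_add, smul_smul, mul_comm t κ]; abel
  calc ∫⁻ s in Set.Ioo a b, ‖u (s • direction ϑ + t • (ε • normal ϑ)) - hgL.toLp g s‖ₑ ^ 2
      ≤ ∫⁻ s in Set.Ioo a b, (2 * F (s - κ * t) + 2 * ‖G (s - κ * t) - G s‖ₑ ^ 2) := by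
        refine lintegral_mono_ae ?_
        have h1 : ∀ᵐ s ∂volume.restrict (Set.Ioo a b), hgL.toLp g s = g s :=
          ae_restrict_of_ae_restrict_of_subset (fun s hs => ha.trans hs.1) hgL.coeFn_toLp
        filter_upwards [h1, ae_restrict_mem measurableSet_Ioo] with s h1 hs
        have p1 : 0 < s := ha.trans hs.1
        have p2 : 0 < s - κ * t := by linarith [hs.1]
        rw [h1, hpt]
        have e1 : F (s - κ * t) = ‖u (A (s - κ * t, t)) - g (s - κ * t)‖ₑ ^ 2 :=
          Set.indicator_of_mem (by exact p2) _
        have e2 : G s = g s := Set.indicator_of_mem (by exact p1) _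
        have e3 : G (s - κ * t) = g (s - κ * t) := Set.indicator_of_mem (by exact p2) _
        rw [e1, e2, e3]
        simpa using enorm_add_sq_le (u (A (s - κ * t, t)) - g (s - κ * t)) (g (s - κ * t) - g s)
    _ ≤ ∫⁻ s, (2 * F (s - κ * t) + 2 * ‖G (s - κ * t) - G s‖ₑ ^ 2) := setLIntegral_le_lintegral _ _
    _ = 2 * (∫⁻ s, F (s - κ * t)) + 2 * ∫⁻ s, ‖G (s - κ * t) - G s‖ₑ ^ 2 := by
        rw [lintegral_add_left (by fun_prop), lintegral_const_mul' _ _ (by simp),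
            lintegral_const_mul' _ _ (by simp)]
    _ = 2 * (∫⁻ s in Set.Ioi 0, ‖u (A (s, t)) - g s‖ₑ ^ 2)
          + 2 * ∫⁻ s, ‖G (s - κ * t) - G s‖ₑ ^ 2 := by
        rw [lintegral_sub_right_eq_self F (κ * t), hF, lintegral_indicator measurableSet_Ioi]
    _ ≤ _ := by
        gcongr
        exact ht ht0

end OneSidedTraces

/-! ### Jumps -/

section LocalConvergence

/-- Convergence of `f t` to `g` as `t → 0⁺` in `L²` on compact subintervals of `(0, ∞)`, along
almost all `t`. Both `IsTrace` and `IsJump` are instances of it. -/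
def TendstoLocL2 (f : ℝ → ℝ → ℂ) (g : L2Branch) : Prop :=
  ∀ a b : ℝ, 0 < a → a < b →
    Tendsto (fun t : ℝ => ∫⁻ s in Set.Ioo a b, ‖f t s - g s‖ₑ ^ 2)
      (𝓝[>] (0 : ℝ) ⊓ ae volume) (𝓝 0)

variable {f f' : ℝ → ℝ → ℂ} {g g' : L2Branch}

theorem ae_Ioo_of_ae_Ioi {p : ℝ → Prop} {a b : ℝ} (ha : 0 < a)
    (h : ∀ᵐ s ∂(volume : Measure ℝ).restrict (Set.Ioi 0), p s) :
    ∀ᵐ s ∂(volume : Measure ℝ).restrict (Set.Ioo a b), p s :=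
  ae_restrict_of_ae_restrict_of_subset (fun _ hs => ha.trans hs.1) h

/-- The filter in the definition of the jump is proper, so that limits along it are unique. -/
instance : (𝓝[>] (0 : ℝ) ⊓ ae (volume : Measure ℝ)).NeBot := by
  rw [inf_neBot_iff]
  intro s hs t ht
  obtain ⟨b, hb, hsub⟩ := mem_nhdsGT_iff_exists_Ioo_subset.1 hs
  by_contra h
  rw [Set.not_nonempty_iff_eq_empty] at h
  have h1 : Set.Ioo 0 b ⊆ tᶜ := fun x hx hxt =>
    (h ▸ (⟨hsub hx, hxt⟩ : x ∈ s ∩ t) : x ∈ (∅ : Set ℝ))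
  have h2 := measure_mono_null h1 (mem_ae_iff.1 ht)
  rw [Real.volume_Ioo, sub_zero, ENNReal.ofReal_eq_zero] at h2
  exact absurd hb (not_lt.2 h2)

theorem TendstoLocL2.congr (h : TendstoLocL2 f g) (hf : ∀ᵐ t : ℝ, ∀ᵐ s : ℝ, f t s = f' t s) :
    TendstoLocL2 f' g := by
  intro a b ha hab
  refine (h a b ha hab).congr' ?_
  refine Filter.Eventually.filter_mono inf_le_right ?_
  filter_upwards [hf] with t ht
  refine lintegral_congr_ae (ae_restrict_of_ae ?_)
  filter_upwards [ht] with s hs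
  rw [hs]

theorem TendstoLocL2.add (hfm : ∀ t, Measurable (f t)) (h : TendstoLocL2 f g)
    (h' : TendstoLocL2 f' g') : TendstoLocL2 (fun t s => f t s + f' t s) (g + g') := by
  intro a b ha hab
  have h1 := ENNReal.Tendsto.const_mul (a := 2) (h a b ha hab) (Or.inr (by simp))
  have h2 := ENNReal.Tendsto.const_mul (a := 2) (h' a b ha hab) (Or.inr (by simp))
  have h3 := h1.add h2
  rw [mul_zero, add_zero] at h3
  refine tendsto_of_tendsto_of_tendsto_of_le_of_le tendsto_const_nhds h3
    (fun _ => zero_le) fun t => ?_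
  have hgm := (Lp.stronglyMeasurable g).measurable
  have hm : Measurable fun s => 2 * ‖f t s - g s‖ₑ ^ 2 :=
    (((hfm t).sub hgm).enorm.pow_const 2).const_mul 2
  simp only
  rw [← lintegral_const_mul' _ _ (by simp), ← lintegral_const_mul' _ _ (by simp),
    ← lintegral_add_left hm]
  refine lintegral_mono_ae ?_
  filter_upwards [ae_Ioo_of_ae_Ioi ha (Lp.coeFn_add g g')] with s hs
  rw [hs, Pi.add_apply]
  simpa [add_sub_add_comm] using enorm_add_sq_le (f t s - g s) (f' t s - g' s)

theorem TendstoLocL2.const_smul (c : ℂ) (h : TendstoLocL2 f g) :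
    TendstoLocL2 (fun t s => c * f t s) (c • g) := by
  intro a b ha hab
  have h1 := ENNReal.Tendsto.const_mul (a := ‖c‖ₑ ^ 2) (h a b ha hab) (Or.inr (by finiteness))
  rw [mul_zero] at h1
  refine h1.congr fun t => ?_
  rw [← lintegral_const_mul' _ _ (by finiteness)]
  refine lintegral_congr_ae ?_
  filter_upwards [ae_Ioo_of_ae_Ioi ha (Lp.coeFn_smul c g)] with s hs
  rw [hs, Pi.smul_apply, smul_eq_mul, ← mul_sub, enorm_mul, mul_pow]

theorem TendstoLocL2.sub (hfm : ∀ t, Measurable (f t)) (h : TendstoLocL2 f g)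
    (h' : TendstoLocL2 f' g') : TendstoLocL2 (fun t s => f t s - f' t s) (g - g') := by
  have := h.add hfm (h'.const_smul (-1))
  simpa [sub_eq_add_neg] using this

theorem TendstoLocL2.eq_zero (h : TendstoLocL2 (fun _ _ => 0) g) : g = 0 := by
  have h1 : ∀ n : ℕ, ∀ᵐ s : ℝ, s ∈ Set.Ioo (1 / ((n : ℝ) + 1)) (n + 2) → g s = 0 := by
    intro n
    have hn : (0 : ℝ) < 1 / ((n : ℝ) + 1) := by positivity
    have hlt : 1 / ((n : ℝ) + 1) < n + 2 := by
      rw [div_lt_iff₀ (by positivity)]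
      have : (0 : ℝ) ≤ n := n.cast_nonneg
      nlinarith
    have h2 := tendsto_nhds_unique (h _ _ hn hlt) tendsto_const_nhds
    have hgm := (Lp.stronglyMeasurable g).measurable
    rw [eq_comm, lintegral_eq_zero_iff (by fun_prop)] at h2
    rw [← ae_restrict_iff' measurableSet_Ioo]
    filter_upwards [h2] with s hs
    simpa using hs
  rw [Lp.eq_zero_iff_ae_eq_zero, EventuallyEq, ae_restrict_iff' measurableSet_Ioi]
  filter_upwards [ae_all_iff.2 h1] with s hs hpos
  obtain ⟨n, hn⟩ := exists_nat_gt (max s (1 / s))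
  refine hs n ⟨?_, ?_⟩
  · have h3 := (le_max_right s (1 / s)).trans_lt hn
    have hpos : 0 < s := hpos
    rw [div_lt_iff₀ (by positivity)] at h3 ⊢
    nlinarith
  · have := (le_max_left s (1 / s)).trans_lt hn
    linarith

theorem TendstoLocL2.unique (hfm : ∀ t, Measurable (f t)) (h : TendstoLocL2 f g)
    (h' : TendstoLocL2 f g') : g = g' := by
  have := h.sub hfm h'
  simp only [sub_self] at this
  exact sub_eq_zero.1 this.eq_zero

end LocalConvergence

section Jump

variable {ϑ : ℝ} {u v : L2Plane} {g h : L2Branch}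

theorem measurable_jump_difference (ϑ : ℝ) (u : L2Plane) (t : ℝ) : Measurable fun s : ℝ =>
    u (s • direction ϑ + t • normal ϑ) - u (s • direction ϑ - t • normal ϑ) := by
  have := measurable_coe u
  fun_prop

/-- A property of almost all points holds at almost all points of almost all parallels to a
half-line. -/
theorem ae_ae_parallel {p : Plane → Prop} (hp : ∀ᵐ x, p x) (ϑ : ℝ) :
    ∀ᵐ t : ℝ, ∀ᵐ s : ℝ,
      p (s • direction ϑ + t • normal ϑ) ∧ p (s • direction ϑ - t • normal ϑ) := by
  have key : ∀ ε : ℝ, ε ≠ 0 → ∀ᵐ t : ℝ, ∀ᵐ s : ℝ, p (s • direction ϑ + t • (ε • normal ϑ)) := by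
    intro ε hε
    have h1 := (quasiMeasurePreserving_coord (oblique ϑ 0 hε)).ae hp
    have h2 := (Measure.measurePreserving_swap (μ := (volume : Measure ℝ))
        (ν := (volume : Measure ℝ))).quasiMeasurePreserving.ae h1
    have h3 := Measure.ae_ae_of_ae_prod h2
    simpa [oblique_apply] using h3
  filter_upwards [key 1 one_ne_zero, key (-1) (by norm_num)] with t h1 h2
  filter_upwards [h1, h2] with s h1 h2
  exact ⟨by simpa using h1, by simpa [sub_eq_add_neg] using h2⟩

theorem IsJump.unique (hg : IsJump ϑ u g) (hh : IsJump ϑ u h) : g = h :=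
  TendstoLocL2.unique (measurable_jump_difference ϑ u) hg hh

theorem IsJump.add (hg : IsJump ϑ u g) (hh : IsJump ϑ v h) : IsJump ϑ (u + v) (g + h) := by
  refine TendstoLocL2.congr (TendstoLocL2.add (measurable_jump_difference ϑ u) hg hh) ?_
  filter_upwards [ae_ae_parallel (Lp.coeFn_add u v) ϑ] with t ht
  filter_upwards [ht] with s hs
  rw [hs.1, hs.2, Pi.add_apply, Pi.add_apply]
  ring

theorem IsJump.const_smul (c : ℂ) (hg : IsJump ϑ u g) : IsJump ϑ (c • u) (c • g) := by
  refine TendstoLocL2.congr (TendstoLocL2.const_smul c hg) ?_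
  filter_upwards [ae_ae_parallel (Lp.coeFn_smul c u) ϑ] with t ht
  filter_upwards [ht] with s hs
  rw [hs.1, hs.2, Pi.smul_apply, Pi.smul_apply]
  simp [mul_sub]

theorem IsJump.sub (hg : IsJump ϑ u g) (hh : IsJump ϑ v h) : IsJump ϑ (u - v) (g - h) := by
  simpa [sub_eq_add_neg] using hg.add (hh.const_smul (-1))

theorem isJump_zero : IsJump ϑ 0 0 := by
  intro a b ha _
  refine tendsto_const_nhds.congr' ?_
  refine Filter.Eventually.filter_mono inf_le_right ?_
  filter_upwards [ae_ae_parallel (Lp.coeFn_zero ℂ 2 (volume : Measure Plane)) ϑ] with t ht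
  symm
  rw [lintegral_eq_zero_iff']
  · filter_upwards [ae_restrict_of_ae ht,
      ae_Ioo_of_ae_Ioi ha (Lp.coeFn_zero ℂ 2 ((volume : Measure ℝ).restrict (Set.Ioi 0)))]
      with s h1 h2
    rw [h1.1, h1.2, h2]
    simp
  · have := measurable_jump_difference ϑ 0 t
    have h2 := (Lp.stronglyMeasurable (0 : L2Branch)).measurable
    exact ((this.sub h2).enorm.pow_const 2).aemeasurable

theorem jump_eq (hg : IsJump ϑ u g) : jump ϑ u = g := by
  have hex : ∃ g, IsJump ϑ u g := ⟨g, hg⟩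
  rw [jump, dif_pos hex]
  exact hex.choose_spec.unique hg

/-- Functions in `H¹(ℝ² \ Γ)` have a jump, bounded by the `H¹` norm. -/
theorem exists_isJump {M : ℕ} (θ : Fin M → ℝ) (ϑ : ℝ) :
    ∃ C : ℝ, ∀ (u : L2Plane) (w : Fin 2 → L2Plane),
      (∀ i, HasWeakPartial (starGraph θ)ᶜ i u (w i)) →
      ∃ g : L2Branch, IsJump ϑ u g ∧ ‖g‖ ≤ C * (‖u‖ + ‖w 0‖ + ‖w 1‖) := by
  obtain ⟨c₁, h₁⟩ := exists_isTrace θ ϑ (ε := 1) (by simp)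
  obtain ⟨c₂, h₂⟩ := exists_isTrace θ ϑ (ε := -1) (by simp)
  refine ⟨√c₁ + √c₂, fun u w huw => ?_⟩
  obtain ⟨g₁, t₁, b₁⟩ := h₁ u w huw
  obtain ⟨g₂, t₂, b₂⟩ := h₂ u w huw
  refine ⟨g₁ - g₂, ?_, ?_⟩
  · have hm : ∀ t : ℝ, Measurable fun s : ℝ => u (s • direction ϑ + t • ((1 : ℝ) • normal ϑ)) := by
      have := measurable_coe u
      intro t
      fun_prop
    have := TendstoLocL2.sub hm t₁ t₂
    refine this.congr (Eventually.of_forall fun t => Eventually.of_forall fun s => ?_)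
    simp [sub_eq_add_neg]
  · have key : ∀ (c : NNReal) (g : L2Branch),
        ‖g‖ₑ ^ 2 ≤ c * (‖u‖ₑ + ‖w 0‖ₑ + ‖w 1‖ₑ) ^ 2 → ‖g‖ ≤ √c * (‖u‖ + ‖w 0‖ + ‖w 1‖) := by
      intro c g h
      have h' : ‖g‖₊ ^ 2 ≤ c * (‖u‖₊ + ‖w 0‖₊ + ‖w 1‖₊) ^ 2 := by
        simp only [enorm_eq_nnnorm] at h
        exact_mod_cast h
      have h2 : ‖g‖ ^ 2 ≤ c * (‖u‖ + ‖w 0‖ + ‖w 1‖) ^ 2 := by exact_mod_cast h'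
      refine abs_le_of_sq_le_sq' ?_ (by positivity) |>.2
      rwa [mul_pow, Real.sq_sqrt c.coe_nonneg]
    calc ‖g₁ - g₂‖ ≤ ‖g₁‖ + ‖g₂‖ := norm_sub_le _ _
      _ ≤ _ := by
        rw [add_mul]
        exact add_le_add (key _ _ b₁) (key _ _ b₂)

/-- Continuous functions have no jump. -/
theorem isJump_zero_of_continuous {φ : Plane → ℂ} (hφ : Continuous φ) (hc : HasCompactSupport φ)
    (hu : u =ᵐ[volume] φ) : IsJump ϑ u 0 := by
  suffices h : TendstoLocL2 (fun t s =>
      φ (s • direction ϑ + t • normal ϑ) - φ (s • direction ϑ - t • normal ϑ)) 0 by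
    refine h.congr ?_
    filter_upwards [ae_ae_parallel hu ϑ] with t ht
    filter_upwards [ht] with s hs
    rw [hs.1, hs.2]
  intro a b ha hab
  refine Tendsto.mono_left ?_ (inf_le_left.trans nhdsWithin_le_nhds)
  have huc := hc.uniformContinuous_of_continuous hφ
  rw [Metric.uniformContinuous_iff] at huc
  rw [ENNReal.tendsto_nhds_zero]
  intro η hη
  obtain ⟨δ, hδ, hδη⟩ : ∃ δ : ℝ, 0 < δ ∧ ENNReal.ofReal δ ^ 2 * ENNReal.ofReal (b - a) ≤ η := by
    have t1 : Tendsto (fun δ : ℝ => ENNReal.ofReal δ ^ 2 * ENNReal.ofReal (b - a)) (𝓝 0) (𝓝 0) := by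
      have : Tendsto ENNReal.ofReal (𝓝 (0 : ℝ)) (𝓝 0) := by
        simpa using ENNReal.tendsto_ofReal (tendsto_id (x := 𝓝 (0 : ℝ)))
      have t2 := ENNReal.Tendsto.pow (n := 2) this
      have t3 := ENNReal.Tendsto.mul_const (b := ENNReal.ofReal (b - a)) t2 (Or.inr (by simp))
      simpa using t3
    have t2 := (t1.mono_left (nhdsWithin_le_nhds (s := Set.Ioi 0)))
    have := (ENNReal.tendsto_nhds_zero.1 t2 η hη).and self_mem_nhdsWithin
    obtain ⟨δ, h1, h2⟩ := this.exists
    exact ⟨δ, h2, h1⟩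
  obtain ⟨r, hr, hrδ⟩ := huc δ hδ
  have ht0 : Tendsto (fun t : ℝ => ‖(2 * t) • normal ϑ‖) (𝓝 0) (𝓝 0) := by
    have : Continuous fun t : ℝ => ‖(2 * t) • normal ϑ‖ := by fun_prop
    simpa using this.tendsto 0
  filter_upwards [ht0.eventually_lt_const hr] with t ht
  calc ∫⁻ s in Set.Ioo a b, ‖φ (s • direction ϑ + t • normal ϑ) - φ (s • direction ϑ - t • normal ϑ)
        - (0 : L2Branch) s‖ₑ ^ 2
      ≤ ∫⁻ _ in Set.Ioo a b, ENNReal.ofReal δ ^ 2 := by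
        refine lintegral_mono_ae ?_
        filter_upwards [ae_Ioo_of_ae_Ioi ha
          (Lp.coeFn_zero ℂ 2 ((volume : Measure ℝ).restrict (Set.Ioi 0)))] with s hs
        rw [hs, Pi.zero_apply, sub_zero]
        gcongr
        rw [← ofReal_norm]
        refine ENNReal.ofReal_le_ofReal ?_
        rw [← dist_eq_norm]
        refine (hrδ ?_).le
        rw [dist_eq_norm]
        refine lt_of_eq_of_lt ?_ ht
        congr 1
        rw [two_mul, add_smul]; abel
    _ = ENNReal.ofReal δ ^ 2 * ENNReal.ofReal (b - a) := by
        rw [lintegral_const, Measure.restrict_apply_univ, Real.volume_Ioo]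
    _ ≤ η := hδη

end Jump

/-! ### Operators generated by closed forms -/

section FormOperators

variable {H V : Type*} [NormedAddCommGroup H] [InnerProductSpace ℂ H]
  [NormedAddCommGroup V] [InnerProductSpace ℂ V]

/-- An approximate eigenvalue belongs to the spectrum. -/
theorem mem_spec_of_approx {T : H →ₗ.[ℂ] H} {z : ℂ}
    (h : ∀ ε > 0, ∃ u F : H, (u, F) ∈ T.graph ∧ u ≠ 0 ∧ ‖F - z • u‖ ≤ ε * ‖u‖) :
    z ∈ spec T := by
  rintro ⟨R, -, hR⟩
  obtain ⟨u, F, huF, hu0, hle⟩ := h (1 / (‖R‖ + 1)) (by positivity)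
  obtain ⟨y, rfl, rfl⟩ := LinearPMap.mem_graph_iff T |>.1 huF
  have h1 := R.le_opNorm (T y - z • (y : H))
  rw [hR] at h1
  have hpos : 0 < ‖(y : H)‖ := norm_pos_iff.2 hu0
  have h2 : ‖R‖ * ‖T y - z • (y : H)‖ ≤ ‖R‖ * (1 / (‖R‖ + 1) * ‖(y : H)‖) := by
    gcongr
  have h3 : ‖R‖ * (1 / (‖R‖ + 1) * ‖(y : H)‖) < ‖(y : H)‖ := by
    rw [← mul_assoc, mul_one_div]
    have : ‖R‖ / (‖R‖ + 1) < 1 := (div_lt_one (by positivity)).2 (by linarith)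
    nlinarith
  linarith

/-- If the spectrum is the half-line `[0, ∞)`, it has no isolated points. -/
theorem specDisc_eq_empty {T : H →ₗ.[ℂ] H} (h : spec T = (fun x : ℝ => (x : ℂ)) '' Set.Ici 0) :
    specDisc T = ∅ := by
  rw [Set.eq_empty_iff_forall_notMem]
  rintro z ⟨hz, ⟨ε, hε, hiso⟩, -⟩
  rw [h] at hz hiso
  obtain ⟨x, hx, rfl⟩ := hz
  have hmem : ((x + ε / 2 : ℝ) : ℂ) ∈
      (fun x : ℝ => (x : ℂ)) '' Set.Ici 0 ∩ Metric.ball (x : ℂ) ε := by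
    refine ⟨⟨_, by have : 0 ≤ x := hx; exact add_nonneg this (by positivity), rfl⟩, ?_⟩
    rw [Metric.mem_ball, dist_eq_norm, ← Complex.ofReal_sub, Complex.norm_real, add_sub_cancel_left,
      Real.norm_of_nonneg (by positivity)]
    linarith
  simp only at hiso
  rw [hiso, Set.mem_singleton_iff, Complex.ofReal_inj] at hmem
  linarith

variable [CompleteSpace H] [CompleteSpace V] (J : V →L[ℂ] H)

/-- The operator `J J†`. For a Hilbert space `V` embedded by `J` in `H`, it is the inverse of
`T + 1`, where `T` is the operator generated by the form `⟨u, v⟩_V - ⟨J u, J v⟩_H`. -/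
def formResolvent : H →L[ℂ] H := J ∘L ContinuousLinearMap.adjoint J

theorem isPositive_formResolvent : (formResolvent J).IsPositive :=
  ContinuousLinearMap.isPositive_self_comp_adjoint J

theorem formResolvent_inner (x y : H) :
    inner ℂ (formResolvent J x) y = inner ℂ x (formResolvent J y) :=
  (isPositive_formResolvent J).isSelfAdjoint.isSymmetric x y

variable {J}

theorem norm_formResolvent_le (hJ : ∀ v, ‖J v‖ ≤ ‖v‖) : ‖formResolvent J‖ ≤ 1 := by
  have h1 : ‖J‖ ≤ 1 := J.opNorm_le_bound zero_le_one (by simpa using hJ)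
  calc ‖formResolvent J‖ ≤ ‖J‖ * ‖ContinuousLinearMap.adjoint J‖ :=
        ContinuousLinearMap.opNorm_comp_le _ _
    _ = ‖J‖ * ‖J‖ := by rw [LinearIsometryEquiv.norm_map]
    _ ≤ 1 := by nlinarith [norm_nonneg J]

theorem formResolvent_injective (hinj : Function.Injective J)
    (hd : ∀ x, ContinuousLinearMap.adjoint J x = 0 → x = 0) {x : H}
    (hx : formResolvent J x = 0) : x = 0 :=
  hd x (hinj (by simpa [formResolvent] using hx))

theorem eq_formResolvent_iff (u F : H) : u = formResolvent J (u + F) ↔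
    ∃ U : V, J U = u ∧ ∀ v : V, inner ℂ v U = inner ℂ (J v) (u + F) := by
  constructor
  · intro h
    exact ⟨_, h.symm, fun v => ContinuousLinearMap.adjoint_inner_right J v (u + F)⟩
  · rintro ⟨U, rfl, hU⟩
    have : U = ContinuousLinearMap.adjoint J (J U + F) := by
      refine ext_inner_left ℂ fun v => ?_
      rw [hU, ContinuousLinearMap.adjoint_inner_right]
    conv_lhs => rw [this]
    rfl

/-- The operator `(J J†)⁻¹ - 1` is self-adjoint. The hypothesis `hd` says that the range of `J` is
dense. -/
theorem exists_selfAdjoint_of_form (hinj : Function.Injective J)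
    (hd : ∀ x, ContinuousLinearMap.adjoint J x = 0 → x = 0) :
    ∃ T : H →ₗ.[ℂ] H, IsSelfAdjoint T ∧
      ∀ u F : H, (u, F) ∈ T.graph ↔ u = formResolvent J (u + F) := by
  set R := formResolvent J with hR
  have hRinj : ∀ x, R x = 0 → x = 0 := fun x => formResolvent_injective hinj hd
  let g : Submodule ℂ (H × H) :=
    { carrier := {p | p.1 = R (p.1 + p.2)}
      add_mem' := by
        rintro ⟨a, b⟩ ⟨c, d⟩ (h1 : a = R (a + b)) (h2 : c = R (c + d))
        change a + c = R (a + c + (b + d))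
        rw [add_add_add_comm, map_add, ← h1, ← h2]
      zero_mem' := by simp
      smul_mem' := by
        rintro k ⟨a, b⟩ (h1 : a = R (a + b))
        change k • a = R (k • a + k • b)
        rw [← smul_add, map_smul, ← h1] }
  have hgm : ∀ u F : H, (u, F) ∈ g ↔ u = R (u + F) := fun u F => Iff.rfl
  have hg : ∀ x ∈ g, x.1 = 0 → x.2 = 0 := by
    rintro ⟨a, b⟩ h1 (h2 : a = 0)
    rw [hgm, h2, zero_add] at h1
    exact hRinj _ h1.symm
  have hgraph : g.toLinearPMap.graph = g := g.toLinearPMap_graph_eq hg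
  have hmem : ∀ f : H, (R f, f - R f) ∈ g := fun f => by rw [hgm, add_sub_cancel]
  have hdense : Dense (g.toLinearPMap.domain : Set H) := by
    refine Submodule.dense_iff_topologicalClosure_eq_top.2 ?_
    rw [Submodule.topologicalClosure_eq_top_iff, Submodule.eq_bot_iff]
    intro x hx
    refine hRinj x ?_
    have h3 : ∀ y, inner ℂ (R y) x = 0 := fun y =>
      (Submodule.mem_orthogonal _ _).1 hx _ ⟨_, hmem y, rfl⟩
    have h4 := h3 (R x)
    rw [formResolvent_inner] at h4
    exact inner_self_eq_zero.1 h4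
  refine ⟨g.toLinearPMap, ?_, fun u F => by rw [hgraph, hgm]⟩
  rw [LinearPMap.isSelfAdjoint_def]
  refine LinearPMap.eq_of_eq_graph ?_
  -- `(x, y)` is in the graph of the adjoint iff `x - R (x + y)` is orthogonal to everything.
  rw [LinearPMap.adjoint_graph_eq_graph_adjoint hdense, hgraph]
  ext ⟨x, y⟩
  rw [Submodule.mem_adjoint_iff, hgm]
  constructor
  · intro h
    have h1 : ∀ f : H, inner ℂ f (x - R (x + y)) = 0 := fun f => by
      have := h _ _ (hmem f)
      simp only [inner_sub_left, hR, formResolvent_inner] at this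
      rw [inner_sub_right, map_add, inner_add_right, hR]
      linear_combination this
    exact sub_eq_zero.1 (inner_self_eq_zero.1 (h1 _))
  · intro h a b hab
    rw [hgm] at hab
    have e1 : inner ℂ a (x + y) = inner ℂ (a + b) x := by
      conv_lhs => rw [hab, hR, formResolvent_inner, ← hR, ← h]
    rw [inner_add_right, inner_add_left] at e1
    simp only
    linear_combination -e1

open scoped ComplexOrder in
/-- An operator generated by a nonnegative form has its spectrum in `[0, ∞)`. -/
theorem mem_resolventSet_of_form (hJ : ∀ v, ‖J v‖ ≤ ‖v‖) {T : H →ₗ.[ℂ] H}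
    (hT : ∀ u F : H, (u, F) ∈ T.graph ↔ u = formResolvent J (u + F)) {z : ℂ}
    (hz : z ∉ (fun x : ℝ => (x : ℂ)) '' Set.Ici 0) : z ∈ resolventSet T := by
  set R := formResolvent J with hR
  -- `T - z = (1 - (1 + z) R) R⁻¹`, so the resolvent is `R` times the inverse of `1 - (1 + z) R`.
  have hB : IsUnit (1 - (1 + z) • R) := by
    by_cases hz1 : 1 + z = 0
    · simp [hz1]
    set μ : ℂ := (1 + z)⁻¹ with hμ
    have hμ0 : μ ≠ 0 := inv_ne_zero hz1
    -- `μ` would lie in `(0, 1]`, which would make `z = 1 / μ - 1` nonnegative.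
    have hspec : μ ∉ spectrum ℂ R := by
      intro hmem
      have hpos := isPositive_formResolvent J
      have hne : Nontrivial H := by
        by_contra hn
        rw [not_nontrivial_iff_subsingleton] at hn
        have : Subsingleton (H →L[ℂ] H) := ⟨fun a b => by ext x; exact Subsingleton.elim _ _⟩
        simp [spectrum.of_subsingleton] at hmem
      have h1 : ‖μ‖ ≤ 1 := (spectrum.norm_le_norm_of_mem hmem).trans (norm_formResolvent_le hJ)
      have h2 : 0 ≤ μ := by
        have h0 : 0 ≤ R := (ContinuousLinearMap.nonneg_iff_isPositive R).2 hpos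
        exact spectrum_nonneg_of_nonneg h0 hmem
      obtain ⟨r, hr, hrμ⟩ : ∃ r : ℝ, 0 ≤ r ∧ (r : ℂ) = μ := by
        rw [Complex.nonneg_iff] at h2
        exact ⟨μ.re, h2.1, Complex.ext (by simp) (by simp [← h2.2])⟩
      have hr0 : 0 < r := lt_of_le_of_ne hr fun h => hμ0 (by rw [← hrμ, ← h]; simp)
      rw [← hrμ, Complex.norm_real, Real.norm_of_nonneg hr] at h1
      refine hz ⟨r⁻¹ - 1, ?_, ?_⟩
      · simpa using (one_le_inv₀ hr0).2 h1
      · have : (1 + z) = (r : ℂ)⁻¹ := by rw [hrμ, hμ, inv_inv]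
        push_cast
        rw [← this]; ring
    rw [spectrum.notMem_iff] at hspec
    have e : 1 - (1 + z) • R = (1 + z) • (algebraMap ℂ (H →L[ℂ] H) μ - R) := by
      rw [smul_sub, Algebra.algebraMap_eq_smul_one, smul_smul, hμ, mul_inv_cancel₀ hz1, one_smul]
    rw [e]
    exact hspec.smul (Units.mk0 _ hz1)
  obtain ⟨B, hB⟩ := hB
  have hBi1 : ∀ x : H, (↑B⁻¹ : H →L[ℂ] H) (x - (1 + z) • R x) = x := fun x => by
    have := congrArg (fun L : H →L[ℂ] H => L x) (B.inv_mul)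
    simpa [hB] using this
  have hBi2 : ∀ x : H, (↑B⁻¹ : H →L[ℂ] H) x - (1 + z) • R ((↑B⁻¹ : H →L[ℂ] H) x) = x := fun x => by
    have := congrArg (fun L : H →L[ℂ] H => L x) (B.mul_inv)
    simpa [hB] using this
  refine ⟨↑B⁻¹ ∘L R, fun f => ?_, fun u => ?_⟩
  · set y := (↑B⁻¹ : H →L[ℂ] H) (R f) with hy
    have h1 : y - (1 + z) • R y = R f := hBi2 (R f)
    have h2 : (y, f + z • y) ∈ T.graph := by
      rw [hT]
      have : y + (f + z • y) = f + (1 + z) • y := by rw [add_smul, one_smul]; abel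
      rw [this, map_add, map_smul, ← h1]; abel
    obtain ⟨x, hx1, hx2⟩ := (LinearPMap.mem_graph_iff T).1 h2
    simp only at hx1 hx2
    refine ⟨x, hx1, ?_⟩
    rw [hx2, hx1]; abel
  · have h1 := (hT _ _).1 (LinearPMap.mem_graph T u)
    have h2 : R (T u - z • (u : H)) = u - (1 + z) • R u := by
      have e : T u - z • (u : H) = ((u : H) + T u) - (1 + z) • (u : H) := by
        rw [add_smul, one_smul]; abel
      rw [e, map_sub, map_smul, ← h1]
    rw [ContinuousLinearMap.comp_apply, h2, hBi1]

end FormOperators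

/-! ### The form domain as a Hilbert space -/

section WeakDerivatives

theorem inner_toLp {ψ : Plane → ℂ} (hψ : MemLp ψ 2 volume) (u : L2Plane) :
    inner ℂ (hψ.toLp ψ) u = ∫ x, u x * (starRingEnd ℂ) (ψ x) := by
  rw [L2.inner_def]
  refine integral_congr_ae ?_
  filter_upwards [hψ.coeFn_toLp] with x hx
  rw [hx, RCLike.inner_apply]

/-- Pairings with test functions are inner products. -/
theorem exists_inner_eq_integral_mul {ψ : Plane → ℂ} (hψ : Continuous ψ)
    (hc : HasCompactSupport ψ) :
    ∃ Ψ : L2Plane, ∀ u : L2Plane, inner ℂ Ψ u = ∫ x, u x * ψ x := by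
  have hm : MemLp (fun x => (starRingEnd ℂ) (ψ x)) 2 (volume : Measure Plane) :=
    (Complex.continuous_conj.comp hψ).memLp_of_hasCompactSupport
      (hc.comp_left (g := starRingEnd ℂ) (by simp))
  exact ⟨hm.toLp _, fun u => by rw [inner_toLp]; simp⟩

/-- An `L²` function orthogonal to all test functions on an open set vanishes there. -/
theorem ae_eq_zero_of_forall_test {Ω : Set Plane} (hΩ : IsOpen Ω) (hnull : ∀ᵐ x, x ∈ Ω)
    {u : L2Plane} (h : ∀ φ : Plane → ℂ, ContDiff ℝ ∞ φ → HasCompactSupport φ → tsupport φ ⊆ Ω →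
      ∫ x, u x * φ x = 0) : u = 0 := by
  rw [Lp.eq_zero_iff_ae_eq_zero]
  have h1 := hΩ.ae_eq_zero_of_integral_contDiff_smul_eq_zero (μ := volume) (f := u)
    (((Lp.memLp u).locallyIntegrable one_le_two).locallyIntegrableOn Ω) (fun g hg hgc hgΩ => ?_)
  · filter_upwards [h1, hnull] with x h1 h2 using h1 h2
  · have := h (fun x => (g x : ℂ)) (Complex.ofRealCLM.contDiff.comp hg)
      (hgc.comp_left (g := fun r : ℝ => (r : ℂ)) (by simp)) ((closure_mono ?_).trans hgΩ)
    · rw [← this]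
      refine integral_congr_ae (Eventually.of_forall fun x => ?_)
      simp [mul_comm]
    · intro x hx
      simpa using hx

variable {Ω : Set Plane} {i : Fin 2} {u v w w' : L2Plane}

theorem continuous_partialDeriv {φ : Plane → ℂ} (hφ : ContDiff ℝ ∞ φ) (i : Fin 2) :
    Continuous (partialDeriv i φ) :=
  (hφ.continuous_fderiv (by simp)).clm_apply continuous_const

theorem contDiff_partialDeriv {φ : Plane → ℂ} (hφ : ContDiff ℝ ∞ φ) (i : Fin 2) :
    ContDiff ℝ ∞ (partialDeriv i φ) :=
  (hφ.fderiv_right (m := ∞) (by simp)).clm_apply contDiff_const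

theorem partialDeriv_conj {φ : Plane → ℂ} (hφ : Differentiable ℝ φ) (i : Fin 2) (x : Plane) :
    partialDeriv i (fun y => (starRingEnd ℂ) (φ y)) x = (starRingEnd ℂ) (partialDeriv i φ x) := by
  have := (Complex.conjCLE.hasFDerivAt (x := φ x)).comp x (hφ x).hasFDerivAt
  have h2 : fderiv ℝ (fun y => (starRingEnd ℂ) (φ y)) x = _ := this.fderiv
  rw [partialDeriv, h2]
  rfl

theorem hasCompactSupport_partialDeriv {φ : Plane → ℂ} (hφ : HasCompactSupport φ) (i : Fin 2) :
    HasCompactSupport (partialDeriv i φ) :=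
  hφ.fderiv_apply ℝ _

theorem tsupport_partialDeriv_subset (φ : Plane → ℂ) (i : Fin 2) :
    tsupport (partialDeriv i φ) ⊆ tsupport φ := by
  refine (closure_mono fun x hx => ?_).trans (tsupport_fderiv_subset ℝ (f := φ))
  rw [Function.mem_support] at hx ⊢
  intro h
  exact hx (by simp [partialDeriv, h])

/-- The condition defining weak derivatives is a family of closed linear conditions. -/
theorem exists_hasWeakPartial_iff (Ω : Set Plane) (i : Fin 2) :
    ∃ S : Set (L2Plane × L2Plane), ∀ u w, HasWeakPartial Ω i u w ↔
      ∀ p ∈ S, inner ℂ p.1 u = -inner ℂ p.2 w := by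
  refine ⟨{p | ∃ φ : Plane → ℂ, ContDiff ℝ ∞ φ ∧ HasCompactSupport φ ∧ tsupport φ ⊆ Ω ∧
    (∀ u : L2Plane, inner ℂ p.1 u = ∫ x, u x * partialDeriv i φ x) ∧
    ∀ u : L2Plane, inner ℂ p.2 u = ∫ x, u x * φ x}, fun u w => ⟨?_, ?_⟩⟩
  · rintro h p ⟨φ, h1, h2, h3, h4, h5⟩
    rw [h4, h5]
    exact h φ h1 h2 h3
  · intro h φ h1 h2 h3
    obtain ⟨a, ha⟩ := exists_inner_eq_integral_mul (continuous_partialDeriv h1 i)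
      (hasCompactSupport_partialDeriv h2 i)
    obtain ⟨b, hb⟩ := exists_inner_eq_integral_mul h1.continuous h2
    rw [← ha, ← hb]
    exact h (a, b) ⟨φ, h1, h2, h3, ha, hb⟩

theorem HasWeakPartial.add (h : HasWeakPartial Ω i u w) (h' : HasWeakPartial Ω i v w') :
    HasWeakPartial Ω i (u + v) (w + w') := by
  obtain ⟨S, hS⟩ := exists_hasWeakPartial_iff Ω i
  rw [hS] at h h' ⊢
  intro p hp
  rw [inner_add_right, inner_add_right, h p hp, h' p hp, neg_add]

theorem HasWeakPartial.const_smul (c : ℂ) (h : HasWeakPartial Ω i u w) :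
    HasWeakPartial Ω i (c • u) (c • w) := by
  obtain ⟨S, hS⟩ := exists_hasWeakPartial_iff Ω i
  rw [hS] at h ⊢
  intro p hp
  rw [inner_smul_right, inner_smul_right, h p hp, mul_neg]

theorem HasWeakPartial.sub (h : HasWeakPartial Ω i u w) (h' : HasWeakPartial Ω i v w') :
    HasWeakPartial Ω i (u - v) (w - w') := by
  simpa [sub_eq_add_neg] using h.add (h'.const_smul (-1))

theorem hasWeakPartial_zero : HasWeakPartial Ω i 0 0 := by
  obtain ⟨S, hS⟩ := exists_hasWeakPartial_iff Ω i
  rw [hS]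
  simp

theorem isClosed_hasWeakPartial (Ω : Set Plane) (i : Fin 2) :
    IsClosed {p : L2Plane × L2Plane | HasWeakPartial Ω i p.1 p.2} := by
  obtain ⟨S, hS⟩ := exists_hasWeakPartial_iff Ω i
  simp only [hS, Set.ofPred_forall]
  exact isClosed_biInter fun p _ => isClosed_eq (by fun_prop) (by fun_prop)

theorem HasWeakPartial.eq_zero (hΩ : IsOpen Ω) (hnull : ∀ᵐ x, x ∈ Ω)
    (h : HasWeakPartial Ω i 0 w) : w = 0 := by
  refine ae_eq_zero_of_forall_test hΩ hnull fun φ h1 h2 h3 => ?_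
  obtain ⟨a, ha⟩ := exists_inner_eq_integral_mul (continuous_partialDeriv h1 i)
    (hasCompactSupport_partialDeriv h2 i)
  have := h φ h1 h2 h3
  rw [← ha, inner_zero_right] at this
  exact neg_eq_zero.1 this.symm

theorem HasWeakPartial.unique (hΩ : IsOpen Ω) (hnull : ∀ᵐ x, x ∈ Ω)
    (h : HasWeakPartial Ω i u w) (h' : HasWeakPartial Ω i u w') : w = w' := by
  have := h.sub h'
  rw [sub_self] at this
  exact sub_eq_zero.1 (this.eq_zero hΩ hnull)

/-- The classical derivative of a smooth function is its weak derivative. -/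
theorem hasWeakPartial_of_contDiff {φ : Plane → ℂ} (hφ : ContDiff ℝ ∞ φ)
    (hc : HasCompactSupport φ) (hu : u =ᵐ[volume] φ) (hw : w =ᵐ[volume] partialDeriv i φ) :
    HasWeakPartial Ω i u w := by
  intro ψ hψ hψc _
  have e1 : ∫ x, u x * partialDeriv i ψ x = ∫ x, φ x * partialDeriv i ψ x := by
    refine integral_congr_ae ?_
    filter_upwards [hu] with x hx
    rw [hx]
  have e2 : ∫ x, w x * ψ x = ∫ x, partialDeriv i φ x * ψ x := by
    refine integral_congr_ae ?_
    filter_upwards [hw] with x hx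
    rw [hx]
  rw [e1, e2]
  refine integral_mul_fderiv_eq_neg_fderiv_mul_of_integrable ?_ ?_ ?_
    (fun x _ => hφ.differentiable (by simp) x) (fun x _ => hψ.differentiable (by simp) x)
  · exact ((continuous_partialDeriv hφ i).mul hψ.continuous).integrable_of_hasCompactSupport
      hψc.mul_left
  · exact (hφ.continuous.mul (continuous_partialDeriv hψ i)).integrable_of_hasCompactSupport
      hc.mul_right
  · exact (hφ.continuous.mul hψ.continuous).integrable_of_hasCompactSupport hψc.mul_left

end WeakDerivatives

section FormSpace

variable {M : ℕ} (θ : Fin M → ℝ)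

/-- The Hilbert space of triples of a function, a vector field and functions on the branches. -/
abbrev Ambient (M : ℕ) : Type :=
  WithLp 2 (L2Plane ×
    WithLp 2 ((PiLp 2 fun _ : Fin 2 => L2Plane) × PiLp 2 fun _ : Fin M => L2Branch))

/-- The form domain as a Hilbert space: the space of triples `(u, ∇u, √α [u])` with
`u ∈ H¹(ℝ² \ Γ)`. Its norm is the form norm `‖u‖² + t(u, u)`. -/
def formSpace (α : ℝ) : Submodule ℂ (Ambient M) where
  carrier := {x | (∀ i, HasWeakPartial (starGraph θ)ᶜ i x.fst (x.snd.fst i)) ∧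
    ∀ j, ∃ g, IsJump (θ j) x.fst g ∧ x.snd.snd j = ((√α : ℝ) : ℂ) • g}
  add_mem' := by
    rintro x y ⟨hx1, hx2⟩ ⟨hy1, hy2⟩
    refine ⟨fun i => (hx1 i).add (hy1 i), fun j => ?_⟩
    obtain ⟨g, hg, hg'⟩ := hx2 j
    obtain ⟨h, hh, hh'⟩ := hy2 j
    refine ⟨g + h, hg.add hh, ?_⟩
    rw [smul_add, ← hg', ← hh']
    rfl
  zero_mem' := ⟨fun i => hasWeakPartial_zero, fun j => ⟨0, isJump_zero, by simp⟩⟩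
  smul_mem' := by
    rintro c x ⟨hx1, hx2⟩
    refine ⟨fun i => (hx1 i).const_smul c, fun j => ?_⟩
    obtain ⟨g, hg, hg'⟩ := hx2 j
    refine ⟨c • g, hg.const_smul c, ?_⟩
    rw [smul_comm, ← hg']
    rfl

variable {θ} {α : ℝ}

theorem hasWeakPartial_unique {i : Fin 2} {u w w' : L2Plane}
    (h : HasWeakPartial (starGraph θ)ᶜ i u w) (h' : HasWeakPartial (starGraph θ)ᶜ i u w') :
    w = w' :=
  h.unique (isClosed_starGraph θ).isOpen_compl (ae_mem_compl_starGraph θ) h'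

theorem weakPartial_eq {i : Fin 2} {u w : L2Plane}
    (h : HasWeakPartial (starGraph θ)ᶜ i u w) : weakPartial θ i u = w := by
  have hex : ∃ w, HasWeakPartial (starGraph θ)ᶜ i u w := ⟨w, h⟩
  rw [weakPartial, dif_pos hex]
  exact hasWeakPartial_unique hex.choose_spec h

/-- The form domain is complete, because weak derivatives are closed and the jump is bounded. -/
theorem isClosed_formSpace : IsClosed (formSpace θ α : Set (Ambient M)) := by
  refine IsSeqClosed.isClosed fun x y hx hxy => ?_
  have l1 : Tendsto (fun n => (x n).fst) atTop (𝓝 y.fst) :=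
    ((by fun_prop : Continuous fun z : Ambient M => z.fst).tendsto y).comp hxy
  have l2 : ∀ i, Tendsto (fun n => (x n).snd.fst i) atTop (𝓝 (y.snd.fst i)) := fun i =>
    ((by fun_prop : Continuous fun z : Ambient M => z.snd.fst i).tendsto y).comp hxy
  have l3 : ∀ j, Tendsto (fun n => (x n).snd.snd j) atTop (𝓝 (y.snd.snd j)) := fun j =>
    ((by fun_prop : Continuous fun z : Ambient M => z.snd.snd j).tendsto y).comp hxy
  have hy : ∀ i, HasWeakPartial (starGraph θ)ᶜ i y.fst (y.snd.fst i) := fun i =>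
    (isClosed_hasWeakPartial _ i).mem_of_tendsto (l1.prodMk_nhds (l2 i))
      (Eventually.of_forall fun n => (hx n).1 i)
  refine ⟨hy, fun j => ?_⟩
  obtain ⟨C, hC⟩ := exists_isJump θ (θ j)
  obtain ⟨g, hg, -⟩ := hC _ _ hy
  refine ⟨g, hg, ?_⟩
  choose h hh hh' using fun n => (hx n).2 j
  have hb : ∀ n, ‖h n - g‖ ≤ C * (‖(x n).fst - y.fst‖ + ‖(x n).snd.fst 0 - y.snd.fst 0‖
      + ‖(x n).snd.fst 1 - y.snd.fst 1‖) := by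
    intro n
    obtain ⟨k, hk, hkb⟩ := hC ((x n).fst - y.fst) (fun i => (x n).snd.fst i - y.snd.fst i)
      (fun i => ((hx n).1 i).sub (hy i))
    rwa [hk.unique ((hh n).sub hg)] at hkb
  have lz : Tendsto (fun n => C * (‖(x n).fst - y.fst‖ + ‖(x n).snd.fst 0 - y.snd.fst 0‖
      + ‖(x n).snd.fst 1 - y.snd.fst 1‖)) atTop (𝓝 0) := by
    have := ((((l1.sub_const y.fst).norm).add ((l2 0).sub_const (y.snd.fst 0)).norm).add
      ((l2 1).sub_const (y.snd.fst 1)).norm).const_mul C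
    simpa using this
  have lg : Tendsto h atTop (𝓝 g) :=
    tendsto_iff_norm_sub_tendsto_zero.2 (squeeze_zero (fun _ => norm_nonneg _) hb lz)
  have l4 := lg.const_smul ((√α : ℝ) : ℂ)
  simp only [← hh'] at l4
  exact tendsto_nhds_unique (l3 j) l4

instance : CompleteSpace (formSpace θ α) := isClosed_formSpace.completeSpace_coe

variable (θ α)

/-- The embedding of the form domain in `L²`. -/
def formEmbedding : formSpace θ α →L[ℂ] L2Plane :=
  WithLp.fstL 2 ℂ L2Plane _ ∘L (formSpace θ α).subtypeL

variable {θ α}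

theorem formEmbedding_injective : Function.Injective (formEmbedding θ α) := by
  rintro ⟨x, hx1, hx2⟩ ⟨y, hy1, hy2⟩ (h : x.fst = y.fst)
  have h1 : ∀ i, x.snd.fst i = y.snd.fst i := fun i =>
    hasWeakPartial_unique (hx1 i) (h ▸ hy1 i)
  have h2 : ∀ j, x.snd.snd j = y.snd.snd j := fun j => by
    obtain ⟨g, hg, hg'⟩ := hx2 j
    obtain ⟨k, hk, hk'⟩ := hy2 j
    rw [hg', hk', hg.unique (h ▸ hk)]
  ext1
  refine WithLp.ofLp_injective 2 (Prod.ext h (WithLp.ofLp_injective 2 (Prod.ext ?_ ?_)))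
  · exact PiLp.ext h1
  · exact PiLp.ext h2

theorem norm_formEmbedding_le (x : formSpace θ α) : ‖formEmbedding θ α x‖ ≤ ‖x‖ :=
  WithLp.norm_fst_le _ (x : Ambient M)

theorem exists_formSpace_iff (u : L2Plane) :
    (∃ x, formEmbedding θ α x = u) ↔ u ∈ sobolevH1 θ := by
  constructor
  · rintro ⟨⟨x, hx1, hx2⟩, rfl⟩ i
    exact ⟨_, hx1 i⟩
  · intro h
    choose w hw using h
    have hj : ∀ j, ∃ g, IsJump (θ j) u g := fun j => by
      obtain ⟨C, hC⟩ := exists_isJump θ (θ j)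
      obtain ⟨g, hg, -⟩ := hC u w hw
      exact ⟨g, hg⟩
    choose g hg using hj
    exact ⟨⟨WithLp.toLp 2 (u, WithLp.toLp 2 (WithLp.toLp 2 w,
      WithLp.toLp 2 fun j => ((√α : ℝ) : ℂ) • g j)), hw, fun j => ⟨g j, hg j, rfl⟩⟩, rfl⟩

theorem inner_formSpace (hα : 0 ≤ α) (x y : formSpace θ α) :
    inner ℂ x y = inner ℂ (formEmbedding θ α x) (formEmbedding θ α y)
      + form θ α (formEmbedding θ α x) (formEmbedding θ α y) := by
  obtain ⟨x, hx1, hx2⟩ := x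
  obtain ⟨y, hy1, hy2⟩ := y
  change inner ℂ x y = inner ℂ x.fst y.fst + form θ α x.fst y.fst
  have hs : ((√α : ℝ) : ℂ) * ((√α : ℝ) : ℂ) = α := by
    rw [← Complex.ofReal_mul, Real.mul_self_sqrt hα]
  have hj : ∀ j, inner ℂ (x.snd.snd j) (y.snd.snd j)
      = (α : ℂ) * inner ℂ (jump (θ j) x.fst) (jump (θ j) y.fst) := fun j => by
    obtain ⟨g, hg, hg'⟩ := hx2 j
    obtain ⟨k, hk, hk'⟩ := hy2 j
    rw [hg', hk', jump_eq hg, jump_eq hk, inner_smul_left, inner_smul_right, Complex.conj_ofReal,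
      ← mul_assoc, hs]
  have hw : ∀ i, inner ℂ (x.snd.fst i) (y.snd.fst i)
      = inner ℂ (weakPartial θ i x.fst) (weakPartial θ i y.fst) := fun i => by
    rw [weakPartial_eq (hx1 i), weakPartial_eq (hy1 i)]
  rw [form, Finset.mul_sum]
  simp only [← hj, ← hw]
  rfl

/-- Test functions on `ℝ² \ Γ` are in the domain of the operator generated by the form, which acts
on them as the Laplacian. -/
theorem form_test {φ : Plane → ℂ} (hφ : ContDiff ℝ ∞ φ) (hc : HasCompactSupport φ)
    (hΩ : tsupport φ ⊆ (starGraph θ)ᶜ) {u F : L2Plane} (hu : u =ᵐ[volume] φ)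
    (hF : F =ᵐ[volume] fun x => -∑ i, partialDeriv i (partialDeriv i φ) x) :
    u ∈ sobolevH1 θ ∧ ∀ v ∈ sobolevH1 θ, form θ α v u = inner ℂ v F := by
  have hm : ∀ i, MemLp (partialDeriv i φ) 2 (volume : Measure Plane) := fun i =>
    (continuous_partialDeriv hφ i).memLp_of_hasCompactSupport (hasCompactSupport_partialDeriv hc i)
  have hw : ∀ i, HasWeakPartial (starGraph θ)ᶜ i u ((hm i).toLp _) := fun i =>
    hasWeakPartial_of_contDiff hφ hc hu (hm i).coeFn_toLp
  refine ⟨fun i => ⟨_, hw i⟩, fun v hv => ?_⟩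
  have hj : ∀ j, jump (θ j) u = 0 := fun j =>
    jump_eq (isJump_zero_of_continuous hφ.continuous hc hu)
  choose z hz using hv
  simp only [form, hj, inner_zero_right, Finset.sum_const_zero, mul_zero, add_zero]
  simp only [fun i => weakPartial_eq (hw i), fun i => weakPartial_eq (hz i)]
  have hm2 : ∀ i, MemLp (partialDeriv i (partialDeriv i φ)) 2 (volume : Measure Plane) := fun i =>
    (continuous_partialDeriv (contDiff_partialDeriv hφ i) i).memLp_of_hasCompactSupport
      (hasCompactSupport_partialDeriv (hasCompactSupport_partialDeriv hc i) i)
  have hF' : F = -∑ i, (hm2 i).toLp _ := by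
    refine Lp.ext (hF.trans ?_)
    rw [Fin.sum_univ_two]
    filter_upwards [Lp.coeFn_neg ((hm2 0).toLp _ + (hm2 1).toLp _),
      Lp.coeFn_add ((hm2 0).toLp _) ((hm2 1).toLp _), (hm2 0).coeFn_toLp, (hm2 1).coeFn_toLp]
      with x h1 h2 h3 h4
    rw [h1, Pi.neg_apply, h2, Pi.add_apply, h3, h4, Fin.sum_univ_two]
  rw [hF', inner_neg_right, inner_sum, ← Finset.sum_neg_distrib]
  refine Finset.sum_congr rfl fun i _ => ?_
  rw [← inner_conj_symm, ← inner_conj_symm v, ← map_neg]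
  congr 1
  rw [inner_toLp, inner_toLp]
  have := hz i (fun x => (starRingEnd ℂ) (partialDeriv i φ x))
    (Complex.conjCLE.contDiff.comp (contDiff_partialDeriv hφ i))
    ((hasCompactSupport_partialDeriv hc i).comp_left (g := starRingEnd ℂ) (by simp)) ?_
  · simp only [partialDeriv_conj ((contDiff_partialDeriv hφ i).differentiable (by simp))] at this
    rw [this, neg_neg]
  · refine (closure_mono fun x hx => ?_).trans ((tsupport_partialDeriv_subset φ i).trans hΩ)
    simpa using hx

/-- The form domain is dense in `L²`. -/
theorem eq_zero_of_orthogonal_sobolevH1 (u : L2Plane)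
    (hu : ∀ v ∈ sobolevH1 θ, inner ℂ v u = 0) : u = 0 := by
  refine ae_eq_zero_of_forall_test (isClosed_starGraph θ).isOpen_compl
    (ae_mem_compl_starGraph θ) fun φ h1 h2 h3 => ?_
  set ψ : Plane → ℂ := fun x => (starRingEnd ℂ) (φ x) with hψ
  have hψs : ContDiff ℝ ∞ ψ := Complex.conjCLE.contDiff.comp h1
  have hψc : HasCompactSupport ψ := h2.comp_left (g := starRingEnd ℂ) (by simp)
  have hψL : MemLp ψ 2 (volume : Measure Plane) :=
    hψs.continuous.memLp_of_hasCompactSupport hψc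
  have hmem : hψL.toLp ψ ∈ sobolevH1 θ := fun i =>
    ⟨_, hasWeakPartial_of_contDiff hψs hψc hψL.coeFn_toLp
      ((continuous_partialDeriv hψs i).memLp_of_hasCompactSupport
        (hasCompactSupport_partialDeriv hψc i)).coeFn_toLp⟩
  have := hu _ hmem
  rw [inner_toLp] at this
  simpa [hψ] using this

/-- The form domain is a Hilbert space `V` for the form norm, embedded in `L²`. -/
theorem exists_form_hilbertSpace (θ : Fin M → ℝ) (hα : 0 ≤ α) :
    ∃ (V : Type) (_ : NormedAddCommGroup V) (_ : InnerProductSpace ℂ V) (_ : CompleteSpace V)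
      (J : V →L[ℂ] L2Plane), Function.Injective J ∧ (∀ v, ‖J v‖ ≤ ‖v‖) ∧
      (∀ u, (∃ v, J v = u) ↔ u ∈ sobolevH1 θ) ∧
      ∀ x y, inner ℂ x y = inner ℂ (J x) (J y) + form θ α (J x) (J y) :=
  ⟨formSpace θ α, inferInstance, inferInstance, inferInstance, formEmbedding θ α,
    formEmbedding_injective, norm_formEmbedding_le, exists_formSpace_iff, inner_formSpace hα⟩

end FormSpace

/-! ### Approximate eigenfunctions and the spectrum -/

section Weyl

/-- The plane wave `exp (i k x₁)`. -/
def planeWave (k : ℝ) (x : Plane) : ℂ := Complex.exp ((k * x 0 : ℝ) * Complex.I)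

theorem norm_planeWave (k : ℝ) (x : Plane) : ‖planeWave k x‖ = 1 :=
  Complex.norm_exp_ofReal_mul_I _

theorem contDiff_planeWave (k : ℝ) : ContDiff ℝ ∞ (planeWave k) := by
  unfold planeWave
  refine ContDiff.cexp (ContDiff.mul (Complex.ofRealCLM.contDiff.comp ?_) contDiff_const)
  exact contDiff_const.mul (EuclideanSpace.proj (𝕜 := ℝ) (0 : Fin 2)).contDiff

theorem partialDeriv_planeWave (k : ℝ) (i : Fin 2) (x : Plane) :
    partialDeriv i (planeWave k) x = (if i = 0 then k * Complex.I else 0) * planeWave k x := by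
  have h1 : HasFDerivAt (fun x : Plane => x 0) (EuclideanSpace.proj (𝕜 := ℝ) (0 : Fin 2)) x :=
    (EuclideanSpace.proj (𝕜 := ℝ) (0 : Fin 2)).hasFDerivAt
  have h2 := ((Complex.ofRealCLM.hasFDerivAt.comp x (h1.const_mul k)).mul_const Complex.I).cexp
  have h3 : fderiv ℝ (planeWave k) x = _ := h2.fderiv
  rw [partialDeriv, h3]
  fin_cases i <;> simp [planeWave, mul_comm]

theorem partialDeriv_mul {f g : Plane → ℂ} (hf : Differentiable ℝ f) (hg : Differentiable ℝ g)
    (i : Fin 2) (x : Plane) : partialDeriv i (fun y => f y * g y) x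
      = partialDeriv i f x * g x + f x * partialDeriv i g x := by
  simp only [partialDeriv]
  rw [fderiv_fun_mul (hf x) (hg x)]
  simp
  ring

theorem partialDeriv_mul_planeWave {f : Plane → ℂ} (hf : Differentiable ℝ f) (k : ℝ)
    (i : Fin 2) (x : Plane) : partialDeriv i (fun y => f y * planeWave k y) x
      = (partialDeriv i f x + (if i = 0 then k * Complex.I else 0) * f x) * planeWave k x := by
  rw [partialDeriv_mul hf ((contDiff_planeWave k).differentiable (by simp)),
    partialDeriv_planeWave]
  ring

theorem laplacian_mul_planeWave {f : Plane → ℂ} (hf : ContDiff ℝ ∞ f) (k : ℝ) (x : Plane) :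
    -(∑ i, partialDeriv i (partialDeriv i fun y => f y * planeWave k y) x)
      - (k ^ 2 : ℝ) * (f x * planeWave k x)
      = -((partialDeriv 0 (partialDeriv 0 f) x + partialDeriv 1 (partialDeriv 1 f) x
        + 2 * k * Complex.I * partialDeriv 0 f x) * planeWave k x) := by
  have hd : Differentiable ℝ f := hf.differentiable (by simp)
  have hd' : ∀ i, Differentiable ℝ (partialDeriv i f) := fun i =>
    (contDiff_partialDeriv hf i).differentiable (by simp)
  have e : ∀ i, partialDeriv i (fun y => f y * planeWave k y) = fun x =>
      (partialDeriv i f x + (if i = 0 then k * Complex.I else 0) * f x) * planeWave k x := fun i =>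
    funext fun x => partialDeriv_mul_planeWave hd k i x
  have e2 : ∀ (i : Fin 2) (c : ℂ) (x : Plane),
      partialDeriv i (fun x => partialDeriv i f x + c * f x) x
      = partialDeriv i (partialDeriv i f) x + c * partialDeriv i f x := fun i c x => by
    change fderiv ℝ (fun x => partialDeriv i f x + c * f x) x (EuclideanSpace.single i 1) = _
    rw [fderiv_fun_add ((hd' i) x) ((hd x).const_mul c), fderiv_const_mul (hd x)]
    simp [partialDeriv]
  have e3 : ∀ i, partialDeriv i (partialDeriv i fun y => f y * planeWave k y) x = _ := fun i => by
    rw [e i, partialDeriv_mul_planeWave (f := fun x => partialDeriv i f x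
      + (if i = 0 then k * Complex.I else 0) * f x) ((hd' i).add (hd.const_mul _)), e2]
  rw [Fin.sum_univ_two, e3, e3]
  push_cast
  linear_combination (-k ^ 2 * f x * planeWave k x) * Complex.I_sq

theorem partialDeriv_comp_affine {f : Plane → ℂ} (hf : Differentiable ℝ f) (r : ℝ) (y : Plane)
    (i : Fin 2) (x : Plane) :
    partialDeriv i (fun z => f (r • (z - y))) x = r * partialDeriv i f (r • (x - y)) := by
  have h1 : HasFDerivAt (fun z : Plane => r • (z - y)) (r • ContinuousLinearMap.id ℝ Plane) x :=
    ((hasFDerivAt_id x).sub_const y).const_smul r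
  have h2 := (hf (r • (x - y))).hasFDerivAt.comp x h1
  have h3 : fderiv ℝ (fun z => f (r • (z - y))) x = _ := h2.fderiv
  rw [partialDeriv, h3]
  simp [partialDeriv]

/-- A smooth cut-off function. -/
theorem exists_cutoff : ∃ χ : Plane → ℂ, ContDiff ℝ ∞ χ ∧ HasCompactSupport χ ∧
    (∀ x, ‖x‖ ≤ 1 → χ x = 1) ∧ ∀ x, 2 < ‖x‖ → χ x = 0 := by
  let b : ContDiffBump (0 : Plane) := ⟨1, 2, one_pos, one_lt_two⟩
  refine ⟨fun x => (b x : ℂ), Complex.ofRealCLM.contDiff.comp b.contDiff,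
    b.hasCompactSupport.comp_left (g := fun r : ℝ => (r : ℂ)) (by simp), fun x hx => ?_,
    fun x hx => ?_⟩
  · change ((b x : ℝ) : ℂ) = 1
    rw [b.one_of_mem_closedBall (by simpa [b] using hx)]; simp
  · change ((b x : ℝ) : ℂ) = 0
    rw [b.zero_of_le_dist (by simpa [b] using hx.le)]; simp

theorem volume_closedBall_two_mul (y : Plane) {R : ℝ} (hR : 0 ≤ R) :
    volume (Metric.closedBall y (2 * R)) = 2 ^ 2 * volume (Metric.closedBall y R) := by
  rw [Measure.addHaar_closedBall' _ _ (by positivity), Measure.addHaar_closedBall' _ _ hR,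
    finrank_euclideanSpace_fin, mul_pow, ENNReal.ofReal_mul (by norm_num), mul_assoc]
  norm_num

variable {M : ℕ} (θ : Fin M → ℝ)

/-- Plane waves of energy `k²`, cut off in large balls of the complement of the graph, are
approximate eigenfunctions of the Laplacian. -/
theorem exists_approx_eigenfunction (k : ℝ) {η : ℝ} (hη : 0 < η) :
    ∃ (φ : Plane → ℂ) (u F : L2Plane), ContDiff ℝ ∞ φ ∧ HasCompactSupport φ ∧
      tsupport φ ⊆ (starGraph θ)ᶜ ∧ u =ᵐ[volume] φ ∧
      (F =ᵐ[volume] fun x => -∑ i, partialDeriv i (partialDeriv i φ) x) ∧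
      u ≠ 0 ∧ ‖F - ((k ^ 2 : ℝ) : ℂ) • u‖ ≤ η * ‖u‖ := by
  obtain ⟨χ, hχ, hχc, hχ1, hχ0⟩ := exists_cutoff
  have hbd : ∃ C : ℝ, 0 ≤ C ∧ ∀ x, ‖partialDeriv 0 (partialDeriv 0 χ) x‖ ≤ C ∧
      ‖partialDeriv 1 (partialDeriv 1 χ) x‖ ≤ C ∧ ‖partialDeriv 0 χ x‖ ≤ C := by
    have hb1 := fun i => hasCompactSupport_partialDeriv hχc i
    have hb2 := fun i => contDiff_partialDeriv hχ i
    obtain ⟨C₁, h₁⟩ := (hasCompactSupport_partialDeriv (hb1 0) 0).exists_bound_of_continuous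
      (continuous_partialDeriv (hb2 0) 0)
    obtain ⟨C₂, h₂⟩ := (hasCompactSupport_partialDeriv (hb1 1) 1).exists_bound_of_continuous
      (continuous_partialDeriv (hb2 1) 1)
    obtain ⟨C₃, h₃⟩ := (hb1 0).exists_bound_of_continuous (hb2 0).continuous
    exact ⟨max C₁ (max C₂ C₃), ((norm_nonneg _).trans (h₁ 0)).trans (le_max_left _ _), fun x =>
      ⟨(h₁ x).trans (by simp), (h₂ x).trans (by simp), (h₃ x).trans (by simp)⟩⟩
  obtain ⟨C, hC0, hC⟩ := hbd
  set D : ℝ := (2 + 2 * |k|) * C with hD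
  have hD0 : 0 ≤ D := by positivity
  -- The cut-off lives on the scale `1 / r`; its derivatives are of order `r`.
  obtain ⟨r, hr0, hr1, hrη⟩ : ∃ r : ℝ, 0 < r ∧ r ≤ 1 ∧ 2 * (r * D) ≤ η := by
    refine ⟨min 1 (η / (2 * D + 1)), by positivity, min_le_left _ _, ?_⟩
    have h1 : min 1 (η / (2 * D + 1)) ≤ η / (2 * D + 1) := min_le_right _ _
    calc 2 * (min 1 (η / (2 * D + 1)) * D) ≤ 2 * (η / (2 * D + 1) * D) := by gcongr
      _ = η * (2 * D / (2 * D + 1)) := by ring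
      _ ≤ η * 1 := by
        gcongr
        exact (div_le_one (by positivity)).2 (by linarith)
      _ = η := mul_one η
  obtain ⟨y, hy⟩ := exists_closedBall_subset_compl θ (2 * r⁻¹) (by positivity)
  set f : Plane → ℂ := fun x => χ (r • (x - y)) with hf
  have hfs : ContDiff ℝ ∞ f := hχ.comp ((contDiff_id.sub contDiff_const).const_smul r)
  have hf0 : Function.support f ⊆ Metric.closedBall y (2 * r⁻¹) := by
    intro x hx
    by_contra h
    refine hx (hχ0 _ ?_)
    rw [Metric.mem_closedBall, not_le, dist_eq_norm] at h
    rw [norm_smul, Real.norm_of_nonneg hr0.le]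
    calc 2 = r * (2 * r⁻¹) := by field_simp
      _ < r * ‖x - y‖ := by gcongr
  have hft : tsupport f ⊆ Metric.closedBall y (2 * r⁻¹) :=
    closure_minimal hf0 Metric.isClosed_closedBall
  set φ : Plane → ℂ := fun x => f x * planeWave k x with hφ
  have hφs : ContDiff ℝ ∞ φ := hfs.mul (contDiff_planeWave k)
  have hφt : tsupport φ ⊆ Metric.closedBall y (2 * r⁻¹) := (tsupport_mul_subset_left).trans hft
  have hφc : HasCompactSupport φ :=
    (isCompact_closedBall y (2 * r⁻¹)).of_isClosed_subset (isClosed_tsupport φ) hφt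
  have hφL : MemLp φ 2 (volume : Measure Plane) :=
    hφs.continuous.memLp_of_hasCompactSupport hφc
  set Lφ : Plane → ℂ := fun x => -∑ i, partialDeriv i (partialDeriv i φ) x with hLφ
  have hLc : Continuous Lφ := by
    refine (continuous_finsetSum _ fun i _ => ?_).neg
    exact continuous_partialDeriv (contDiff_partialDeriv hφs i) i
  have hLt : ∀ x, x ∉ tsupport φ → Lφ x = 0 := by
    intro x hx
    have : ∀ i, partialDeriv i (partialDeriv i φ) x = 0 := fun i => by
      refine image_eq_zero_of_notMem_tsupport fun h => hx ?_
      exact tsupport_partialDeriv_subset _ _ (tsupport_partialDeriv_subset _ _ h)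
    simp [hLφ, this]
  have hLL : MemLp Lφ 2 (volume : Measure Plane) :=
    hLc.memLp_of_hasCompactSupport (HasCompactSupport.intro hφc hLt)
  have hpt : ∀ x, ‖Lφ x - ((k ^ 2 : ℝ) : ℂ) * φ x‖ ≤ r * D := by
    intro x
    simp only [hLφ, hφ]
    rw [laplacian_mul_planeWave hfs, norm_neg, norm_mul, norm_planeWave, mul_one]
    have hχd : Differentiable ℝ χ := hχ.differentiable (by simp)
    have g1 : ∀ i, partialDeriv i f = fun x => (r : ℂ) * partialDeriv i χ (r • (x - y)) := fun i =>
      funext fun x => partialDeriv_comp_affine hχd r y i x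
    have g2 : ∀ i, partialDeriv i (partialDeriv i f) x
        = r * (r * partialDeriv i (partialDeriv i χ) (r • (x - y))) := fun i => by
      have hd := (contDiff_partialDeriv hχ i).differentiable (by simp)
      rw [← partialDeriv_comp_affine hd, g1]
      rw [partialDeriv, fderiv_const_mul]
      · rfl
      · exact hd.differentiableAt.comp x (by fun_prop)
    rw [g2, g2, g1]
    set z := r • (x - y)
    obtain ⟨c1, c2, c3⟩ := hC z
    have hrn : ‖(r : ℂ)‖ = r := by rw [Complex.norm_real, Real.norm_of_nonneg hr0.le]
    have hkn : ‖(2 * k * Complex.I : ℂ)‖ = 2 * |k| := by simp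
    calc _ ≤ ‖(r : ℂ) * (r * partialDeriv 0 (partialDeriv 0 χ) z)‖
          + ‖(r : ℂ) * (r * partialDeriv 1 (partialDeriv 1 χ) z)‖
          + ‖2 * k * Complex.I * (r * partialDeriv 0 χ z)‖ := norm_add₃_le
      _ ≤ r * (1 * C) + r * (1 * C) + 2 * |k| * (r * C) := by
        rw [norm_mul, norm_mul, norm_mul _ (_ * partialDeriv 1 _ _),
          norm_mul _ (partialDeriv 1 _ _), norm_mul _ (_ * partialDeriv 0 _ _),
          norm_mul _ (partialDeriv 0 _ _), hrn, hkn]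
        gcongr
      _ = r * D := by rw [hD]; ring
  refine ⟨φ, hφL.toLp φ, hLL.toLp Lφ, hφs, hφc, hφt.trans hy, hφL.coeFn_toLp, hLL.coeFn_toLp, ?_⟩
  set u := hφL.toLp φ with hu
  set F := hLL.toLp Lφ with hF
  have hlow : volume (Metric.closedBall y r⁻¹) ≤ ‖u‖ₑ ^ 2 := by
    rw [enorm_sq_eq_lintegral]
    calc volume (Metric.closedBall y r⁻¹) = ∫⁻ _ in Metric.closedBall y r⁻¹, 1 := by simp
      _ ≤ ∫⁻ x in Metric.closedBall y r⁻¹, ‖u x‖ₑ ^ 2 := by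
        refine lintegral_mono_ae ?_
        filter_upwards [ae_restrict_of_ae hφL.coeFn_toLp,
          ae_restrict_mem Metric.isClosed_closedBall.measurableSet] with x h1 h2
        have : f x = 1 := by
          refine hχ1 _ ?_
          rw [norm_smul, Real.norm_of_nonneg hr0.le, ← dist_eq_norm]
          calc r * dist x y ≤ r * r⁻¹ := by gcongr; exact h2
            _ = 1 := by field_simp
        rw [h1, hφ]
        simp only
        rw [this, one_mul, ← ofReal_norm, norm_planeWave]
        simp
      _ ≤ _ := setLIntegral_le_lintegral _ _
  have hup : ‖F - ((k ^ 2 : ℝ) : ℂ) • u‖ₑ ^ 2 ≤ ENNReal.ofReal (2 * (r * D)) ^ 2 * ‖u‖ₑ ^ 2 := by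
    rw [enorm_sq_eq_lintegral]
    calc ∫⁻ x, ‖(F - ((k ^ 2 : ℝ) : ℂ) • u : L2Plane) x‖ₑ ^ 2
        ≤ ∫⁻ x, (Metric.closedBall y (2 * r⁻¹)).indicator
            (fun _ => ENNReal.ofReal (r * D) ^ 2) x := by
          refine lintegral_mono_ae ?_
          filter_upwards [Lp.coeFn_sub F (((k ^ 2 : ℝ) : ℂ) • u), Lp.coeFn_smul ((k ^ 2 : ℝ) : ℂ) u,
            hφL.coeFn_toLp, hLL.coeFn_toLp] with x h1 h2 h3 h4
          rw [h1, Pi.sub_apply, h2, Pi.smul_apply, h3, h4, smul_eq_mul]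
          by_cases hx : x ∈ Metric.closedBall y (2 * r⁻¹)
          · rw [Set.indicator_of_mem hx, ← ofReal_norm]
            gcongr
            exact hpt x
          · have hx' : x ∉ tsupport φ := fun h => hx (hφt h)
            rw [hLt x hx', image_eq_zero_of_notMem_tsupport hx']
            simp
      _ = ENNReal.ofReal (r * D) ^ 2 * (2 ^ 2 * volume (Metric.closedBall y r⁻¹)) := by
          rw [lintegral_indicator Metric.isClosed_closedBall.measurableSet, lintegral_const,
            Measure.restrict_apply_univ, volume_closedBall_two_mul _ (by positivity)]
      _ ≤ ENNReal.ofReal (r * D) ^ 2 * (2 ^ 2 * ‖u‖ₑ ^ 2) := by gcongr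
      _ = _ := by
          rw [ENNReal.ofReal_mul zero_le_two, ENNReal.ofReal_ofNat]; ring
  refine ⟨fun h => ?_, ?_⟩
  · rw [h, enorm_zero, zero_pow two_ne_zero] at hlow
    exact absurd hlow (not_le.2 (Metric.measure_closedBall_pos volume y (inv_pos.2 hr0)))
  · rw [← mul_pow] at hup
    have h1 := (ENNReal.pow_le_pow_left_iff two_ne_zero).1 hup
    rw [← ofReal_norm, ← ofReal_norm, ← ENNReal.ofReal_mul (by positivity)] at h1
    exact ((ENNReal.ofReal_le_ofReal_iff (by positivity)).1 h1).trans (by gcongr)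

end Weyl

section GeneratedOperator

variable {M : ℕ} {θ : Fin M → ℝ} {α : ℝ}

/-- The operators generated by the form are those given by `(T + 1)⁻¹ = J J†`, where `J` is the
embedding of the form domain. -/
theorem exists_form_embedding (θ : Fin M → ℝ) (hα : 0 ≤ α) :
    ∃ (V : Type) (_ : NormedAddCommGroup V) (_ : InnerProductSpace ℂ V) (_ : CompleteSpace V)
      (J : V →L[ℂ] L2Plane), Function.Injective J ∧
      (∀ u, ContinuousLinearMap.adjoint J u = 0 → u = 0) ∧ (∀ v, ‖J v‖ ≤ ‖v‖) ∧
      ∀ u F : L2Plane, u = formResolvent J (u + F) ↔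
        u ∈ sobolevH1 θ ∧ ∀ v ∈ sobolevH1 θ, form θ α v u = inner ℂ v F := by
  obtain ⟨V, _, _, _, J, hinj, hJ, hrange, hinner⟩ := exists_form_hilbertSpace θ hα
  refine ⟨V, _, _, ‹_›, J, hinj, fun u hu => ?_, hJ, fun u F => ?_⟩
  · refine eq_zero_of_orthogonal_sobolevH1 (θ := θ) u fun v hv => ?_
    obtain ⟨x, rfl⟩ := (hrange v).2 hv
    have := ContinuousLinearMap.adjoint_inner_right J x u
    rw [hu, inner_zero_right] at this
    exact this.symm
  · rw [eq_formResolvent_iff]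
    constructor
    · rintro ⟨U, rfl, hU⟩
      refine ⟨(hrange _).1 ⟨U, rfl⟩, fun v hv => ?_⟩
      obtain ⟨v, rfl⟩ := (hrange _).2 hv
      have := hU v
      rw [hinner, inner_add_right] at this
      exact add_left_cancel this
    · rintro ⟨hu, h⟩
      obtain ⟨U, rfl⟩ := (hrange _).2 hu
      refine ⟨U, rfl, fun v => ?_⟩
      rw [hinner, inner_add_right, h _ ((hrange _).1 ⟨v, rfl⟩)]

theorem existsUnique_isGeneratedByForm (θ : Fin M → ℝ) (hα : 0 ≤ α) :
    ∃! T : L2Plane →ₗ.[ℂ] L2Plane, IsGeneratedByForm θ α T := by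
  obtain ⟨V, _, _, _, J, hinj, hdense, -, hiff⟩ := exists_form_embedding θ hα
  obtain ⟨T, hT, hTg⟩ := exists_selfAdjoint_of_form hinj hdense
  have hgen : IsGeneratedByForm θ α T := ⟨hT, fun u F => (hTg u F).trans (hiff u F)⟩
  refine ⟨T, hgen, fun T' hT' => LinearPMap.eq_of_eq_graph ?_⟩
  ext ⟨u, F⟩
  rw [hT'.mem_graph_iff, hgen.mem_graph_iff]

theorem IsGeneratedByForm.spec_eq (hα : 0 ≤ α) {T : L2Plane →ₗ.[ℂ] L2Plane}
    (hT : IsGeneratedByForm θ α T) : spec T = (fun x : ℝ => (x : ℂ)) '' Set.Ici 0 := by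
  refine Set.Subset.antisymm (fun z hz => ?_) ?_
  · by_contra h
    obtain ⟨V, _, _, _, J, -, -, hJ, hiff⟩ := exists_form_embedding θ hα
    exact hz (mem_resolventSet_of_form hJ
      (fun u F => (hT.mem_graph_iff u F).trans (hiff u F).symm) h)
  · rintro _ ⟨x, hx, rfl⟩
    refine mem_spec_of_approx fun ε hε => ?_
    obtain ⟨φ, u, F, h1, h2, h3, h4, h5, h6, h7⟩ := exists_approx_eigenfunction θ (√x) hε
    rw [Real.sq_sqrt hx] at h7
    exact ⟨u, F, (hT.mem_graph_iff u F).2 (form_test h1 h2 h3 h4 h5), h6, h7⟩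

end GeneratedOperator

end StarGraph

end

theorem mainTheorem4 (M : ℕ) (hM : 1 ≤ M) (θ : Fin M → ℝ) (hθ : StrictMono θ)
    (hθ_range : ∀ j, θ j ∈ Set.Ico (0 : ℝ) (2 * Real.pi)) (α : ℝ) (hα : 0 ≤ α) :
    (∃! T : StarGraph.L2Plane →ₗ.[ℂ] StarGraph.L2Plane, StarGraph.IsGeneratedByForm θ α T) ∧
    ∀ T : StarGraph.L2Plane →ₗ.[ℂ] StarGraph.L2Plane, StarGraph.IsGeneratedByForm θ α T →
      StarGraph.spec T = (fun x : ℝ => (x : ℂ)) '' Set.Ici 0 ∧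
      StarGraph.specEss T = (fun x : ℝ => (x : ℂ)) '' Set.Ici 0 ∧
      StarGraph.specDisc T = ∅ := by
  refine ⟨StarGraph.existsUnique_isGeneratedByForm θ hα, fun T hT => ?_⟩
  have hspec := hT.spec_eq hα
  have hdisc := StarGraph.specDisc_eq_empty hspec
  exact ⟨hspec, by rw [StarGraph.specEss, hdisc, Set.sdiff_empty, hspec], hdisc⟩
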